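/- **Corollary 2.1 (Smoothness).** Let $A$ be a positive self-adjoint operator with discrete spectrum in a separable Hilbert space $H$ with norm $\|\cdot\|$: there is an orthonormal basis $\{e_j\}_{j\ge1}$ of $H$ with $Ae_j=\mu_je_j$, $0<\mu_1\le\mu_2\le\dots$, $\mu_j\to\infty$. For $\alpha>0$ equip $D(A^\alpha)$ with the norm $\|A^\alpha\cdot\|$. Let $h>0$, $k\in\mathbb R$, and let $$W=C([-h,0];D(A^{1/2}))\cap C^1([-h,0];H),\qquad |\varphi|_W=\max_{[-h,0]}\|A^{1/2}\varphi(\theta)\|+\max_{[-h,0]}\|\dot\varphi(\theta)\| .$$ Let $F:D(A^{1/2})\to H$ and $M:W\to H$ be maps with the following properties. * (F1) For every $R>0$ there is $L_R>0$ with $\|F(u^1)-F(u^2)\|\le L_R\|A^{1/2}(u^1-u^2)\|$ whenever $\|A^{1/2}u^i\|\le R$, $i=1,2$. * (F2) $F=\Pi'+F^*$, where $\Pi'$ is the Fréchet derivative of a $C^1$ functional $\Pi=\Pi_0+\Pi_1:D(A^{1/2})\to\mathbb R$ (so $\Pi'(u)=F(u)-F^*(u)\in H$ acts on $v\in D(A^{1/2})$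 by $v\mapsto\operatorname{Re}(\Pi'(u),v)$); $F^*:D(A^{1/2})\to H$ satisfies $\|F^*(u^1)-F^*(u^2)\|^2\le c_0\|A^{1/2}(u^1-u^2)\|^2$ for all $u^1,u^2$; $\Pi_0\ge0$ is bounded on bounded sets of $D(A^{1/2})$; and for every $\eta>0$ there is $C_\eta>0$ with $|\Pi_1(u)|\le\eta(\|A^{1/2}u\|^2+\Pi_0(u))+C_\eta$ for all $u\in D(A^{1/2})$. * (M1′) For every $\varrho>0$ there is $C_\varrho$ with $\|M(\varphi^1)-M(\varphi^2)\|\le C_\varrho\max_{\theta\in[-h,0]}\|\varphi^1(\theta)-\varphi^2(\theta)\|$ for all $\varphi^1,\varphi^2\in W$ with $|\varphi^j|_W\le\varrho$, $j=1,2$. * (M2) There are $M_0,M_1\ge0$ with $\|M(\varphi)\|\le M_0+M_1|\varphi|_W$ for all $\varphi\in W$. Let $\varphi\in W$ and let $u\in C([-h,\infty);D(A^{1/2}))\cap C^1([-h,\infty);H)$ be the global mild solution of $$\ddot u(t)+k\dot u(t)+Au(t)+F(u(t))+M(u_t)=0,\quad t>0,\qquad u(\theta)=\varphi(\theta),\ \theta\in[-h,0],$$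 where $u_t(\theta)=u(t+\theta)$ for $\theta\in[-h,0]$. That is, $u=\varphi$ on $[-h,0]$ and $U(t)=(u(t);\dot u(t))$ satisfies $$U(t)=e^{-t\mathcal A}U(0)-\int_0^te^{-(t-s)\mathcal A}\bigl(0;F(u(s))+M(u_s)\bigr)\,ds,\qquad t\ge0,$$ where $e^{-t\mathcal A}$ is the $C_0$-semigroup on $D(A^{1/2})\times H$ generated by $-\mathcal A$, $\mathcal A(u;v)=(-v;Au+kv)$, $D(\mathcal A)=D(A)\times D(A^{1/2})$. If $\varphi(0)\in D(A)$ and $\dot\varphi(0)\in D(A^{1/2})$, then for every $T>0$ $$u\in L_\infty(0,T;D(A)),\quad \dot u\in L_\infty(0,T;D(A^{1/2})),\quad \ddot u\in L_\infty(0,T;H),$$ where $\ddot u$ is the derivative of $\dot u$ in the sense of distributions on $(0,T)$. If in addition $F:D(A^{1/2})\to H$ is Fréchet differentiable and for every $r>0$ there is $C_r$ with $\|F'(u)v\|\le C_r\|A^{1/2}v\|$ for all $v\in D(A^{1/2})$ and all $u\in D(A)$ with $\|Au\|\le r$, then $$u\in C(\mathbb R_+;D(A)),\quad \dot u\in C(\mathbb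 R_+;D(A^{1/2})),\quad \ddot u\in C(\mathbb R_+;H),\qquad \mathbb R_+=[0,\infty),$$ where at $t=0$ the derivative $\ddot u(0)$ is one-sided. -/

import Mathlib

open Set Filter Topology MeasureTheory
open scoped ENNReal NNReal ContDiff

noncomputable section

/-- A positive (self-adjoint) operator `A` with discrete spectrum in a Hilbert space `H`, with
domain `D(A) = op.domain`, an orthonormal basis of eigenvectors `A e_k = μ_k e_k` and eigenvalues
`0 < μ_0 ≤ μ_1 ≤ …`, `μ_k → ∞`. -/
structure PosDiscreteOp (𝕜 H : Type*) [RCLike 𝕜] [NormedAddCommGroup H] [InnerProductSpace 𝕜 H]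
    [CompleteSpace H] where
  op : H →ₗ.[𝕜] H
  isSelfAdjoint : IsSelfAdjoint op
  basis : HilbertBasis ℕ 𝕜 H
  eig : ℕ → ℝ
  eig_zero_pos : 0 < eig 0
  eig_mono : Monotone eig
  eig_tendsto : Tendsto eig atTop atTop
  basis_mem : ∀ k, basis k ∈ op.domain
  op_basis : ∀ k, op ⟨basis k, basis_mem k⟩ = (eig k : 𝕜) • basis k

namespace PosDiscreteOp

variable {𝕜 H : Type*} [RCLike 𝕜] [NormedAddCommGroup H] [InnerProductSpace 𝕜 H]
  [CompleteSpace H] (A : PosDiscreteOp 𝕜 H)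

theorem eig_pos (k : ℕ) : 0 < A.eig k :=
  A.eig_zero_pos.trans_le (A.eig_mono (Nat.zero_le k))

/-- The fractional power domain `D(A^α) = {x : ∑ₖ μₖ^{2α} |(x, eₖ)|² < ∞}`, as a subspace of `H`. -/
def powDomain (α : ℝ) : Submodule 𝕜 H where
  carrier := {x | Memℓp (fun k => ((A.eig k ^ α : ℝ) : 𝕜) • (A.basis.repr x k : 𝕜)) 2}
  zero_mem' := by
    have h : (fun k => ((A.eig k ^ α : ℝ) : 𝕜) • (A.basis.repr (0 : H) k : 𝕜)) = 0 := by
      ext k; simp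
    rw [mem_ofPred_eq, h]
    exact zero_memℓp
  add_mem' := by
    intro x y hx hy
    have h : (fun k => ((A.eig k ^ α : ℝ) : 𝕜) • (A.basis.repr (x + y) k : 𝕜)) =
        (fun k => ((A.eig k ^ α : ℝ) : 𝕜) • (A.basis.repr x k : 𝕜)) +
        (fun k => ((A.eig k ^ α : ℝ) : 𝕜) • (A.basis.repr y k : 𝕜)) := by
      ext k; simp [mul_add]
    rw [mem_ofPred_eq, h]
    exact hx.add hy
  smul_mem' := by
    intro c x hx
    have h : (fun k => ((A.eig k ^ α : ℝ) : 𝕜) • (A.basis.repr (c • x) k : 𝕜)) =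
        c • (fun k => ((A.eig k ^ α : ℝ) : 𝕜) • (A.basis.repr x k : 𝕜)) := by
      ext k; simp [mul_left_comm]
    rw [mem_ofPred_eq, h]
    exact hx.const_smul c

/-- The fractional power `A^α x = ∑ₖ μₖ^α (x, eₖ) eₖ` on `D(A^α)`. -/
def apow (α : ℝ) : A.powDomain α →ₗ[𝕜] H where
  toFun x := A.basis.repr.symm
    ⟨fun k => ((A.eig k ^ α : ℝ) : 𝕜) • (A.basis.repr (x : H) k : 𝕜), x.2⟩
  map_add' x y := by
    rw [← map_add]
    congr 1
    ext k
    simp only [Submodule.coe_add, map_add, lp.coeFn_add, Pi.add_apply, smul_add]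
  map_smul' c x := by
    rw [RingHom.id_apply, ← map_smul]
    congr 1
    ext k
    simp [mul_left_comm]

theorem repr_apow (α : ℝ) (x : A.powDomain α) (k : ℕ) :
    A.basis.repr (A.apow α x) k = ((A.eig k ^ α : ℝ) : 𝕜) • (A.basis.repr (x : H) k : 𝕜) := by
  simp [apow]

theorem apow_injective (α : ℝ) : Function.Injective (A.apow α) := by
  rw [injective_iff_map_eq_zero]
  intro x hx
  apply Subtype.ext
  apply A.basis.repr.injective
  ext k
  have h := A.repr_apow α x k
  rw [hx] at h
  have hp : ((A.eig k ^ α : ℝ) : 𝕜) ≠ 0 := by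
    exact_mod_cast (Real.rpow_pos_of_pos (A.eig_pos k) α).ne'
  simp only [map_zero, lp.coeFn_zero, Pi.zero_apply, smul_eq_mul] at h
  have h0 := (mul_eq_zero.mp h.symm).resolve_left hp
  simpa using h0

/-- `D(A^α)` as a normed space of its own, with the norm `x ↦ ‖A^α x‖` (and not the one of `H`). -/
def Dom (α : ℝ) : Type _ := ↥(A.powDomain α)

instance (α : ℝ) : AddCommGroup (A.Dom α) := inferInstanceAs (AddCommGroup (A.powDomain α))

instance (α : ℝ) : Module 𝕜 (A.Dom α) := inferInstanceAs (Module 𝕜 (A.powDomain α))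

/-- The inclusion `D(A^α) ⊆ H`. -/
def incl (α : ℝ) : A.Dom α →ₗ[𝕜] H := (A.powDomain α).subtype

/-- `A^α` on `D(A^α)`. -/
def domPow (α : ℝ) : A.Dom α →ₗ[𝕜] H := A.apow α

instance (α : ℝ) : NormedAddCommGroup (A.Dom α) :=
  NormedAddCommGroup.induced (A.Dom α) H (A.domPow α) (A.apow_injective α)

instance (α : ℝ) : NormedSpace 𝕜 (A.Dom α) := NormedSpace.induced 𝕜 (A.Dom α) H (A.domPow α)

instance (α : ℝ) : NormedSpace ℝ (A.Dom α) := NormedSpace.restrictScalars ℝ 𝕜 (A.Dom α)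

theorem norm_dom (α : ℝ) (x : A.Dom α) : ‖x‖ = ‖A.domPow α x‖ := rfl

theorem repr_op (x : A.op.domain) (k : ℕ) :
    A.basis.repr (A.op x) k = (A.eig k : 𝕜) * A.basis.repr (x : H) k := by
  rw [HilbertBasis.repr_apply_apply, HilbertBasis.repr_apply_apply]
  have hd := A.isSelfAdjoint.dense_domain
  have hf := LinearPMap.adjoint_isFormalAdjoint (T := A.op) hd
  have e : LinearPMap.adjoint A.op = A.op := A.isSelfAdjoint
  rw [e] at hf
  have h := hf ⟨A.basis k, A.basis_mem k⟩ x
  rw [A.op_basis, inner_smul_left] at h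
  simpa using h.symm

/-- The domain of `A` is `D(A^1)`. -/
theorem mem_powDomain_one {x : H} : x ∈ A.powDomain 1 ↔ x ∈ A.op.domain := by
  constructor
  · intro hx
    have hd := A.isSelfAdjoint.dense_domain
    have e : LinearPMap.adjoint A.op = A.op := A.isSelfAdjoint
    rw [← e]
    refine LinearPMap.mem_adjoint_domain_of_exists _ ⟨A.apow 1 ⟨x, hx⟩, fun y => ?_⟩
    rw [← A.basis.repr.inner_map_map, ← A.basis.repr.inner_map_map x, lp.inner_eq_tsum,
      lp.inner_eq_tsum]
    refine tsum_congr fun k => ?_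
    rw [A.repr_apow, A.repr_op]
    simp [mul_comm, mul_left_comm]
  · intro hx
    have h : (fun k => ((A.eig k ^ (1 : ℝ) : ℝ) : 𝕜) • (A.basis.repr x k : 𝕜)) =
        A.basis.repr (A.op ⟨x, hx⟩) := by
      ext k
      rw [A.repr_op]
      simp
    change Memℓp (fun k => ((A.eig k ^ (1 : ℝ) : ℝ) : 𝕜) • (A.basis.repr x k : 𝕜)) 2
    rw [h]
    exact lp.memℓp _

/-- `A^1 = A`. -/
theorem apow_one (x : A.powDomain 1) :
    A.apow 1 x = A.op ⟨x, A.mem_powDomain_one.mp x.2⟩ := by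
  apply A.basis.repr.injective
  ext k
  rw [A.repr_apow, A.repr_op]
  simp

end PosDiscreteOp

section Semigroup

variable {𝕜 Y : Type*} [RCLike 𝕜] [NormedAddCommGroup Y] [NormedSpace 𝕜 Y] [NormedSpace ℝ Y]

/-- `(S t)_{t ≥ 0}` is a `C₀`-semigroup of bounded operators (values at `t < 0` are irrelevant). -/
structure IsC0Semigroup (S : ℝ → Y →L[𝕜] Y) : Prop where
  zero : S 0 = ContinuousLinearMap.id 𝕜 Y
  add : ∀ s t : ℝ, 0 ≤ s → 0 ≤ t → S (s + t) = (S s).comp (S t)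
  tendsto : ∀ y : Y, Tendsto (fun t => S t y) (𝓝[>] 0) (𝓝 y)

/-- `L` is the infinitesimal generator of `S`: `y ∈ D(L)` and `L y = z` if and only if
`(S t y - y) / t → z` as `t ↓ 0`. -/
def IsGenerator (S : ℝ → Y →L[𝕜] Y) (L : Y →ₗ.[𝕜] Y) : Prop :=
  ∀ y z : Y, (∃ hy : y ∈ L.domain, L ⟨y, hy⟩ = z) ↔
    Tendsto (fun t : ℝ => t⁻¹ • (S t y - y)) (𝓝[>] 0) (𝓝 z)

open Classical in
/-- `e^{tL}`, `t ≥ 0`: the `C₀`-semigroup generated by `L` (a `C₀`-semigroup is determined by its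
generator; the value is `0` if `L` does not generate a `C₀`-semigroup). -/
def semigroupOf (L : Y →ₗ.[𝕜] Y) : ℝ → Y →L[𝕜] Y :=
  if hS : ∃ S : ℝ → Y →L[𝕜] Y, IsC0Semigroup S ∧ IsGenerator S L then hS.choose else 0

end Semigroup

section Delay

variable {𝕜 H : Type*} [RCLike 𝕜] [NormedAddCommGroup H] [InnerProductSpace 𝕜 H]
  [CompleteSpace H] (A : PosDiscreteOp 𝕜 H)

/-- The energy space `Y = D(A^{1/2}) × H`. -/
abbrev EnergySpace : Type _ := A.Dom (1 / 2) × H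

/-- The operator `𝒜 (u; v) = (-v; A u + k v)` with domain `D(A) × D(A^{1/2})` in `Y`. -/
def firstOrderOp (k : ℝ) : EnergySpace A →ₗ.[𝕜] EnergySpace A where
  domain := (A.op.domain.comap (A.incl (1 / 2))).prod (A.powDomain (1 / 2))
  toFun :=
    { toFun := fun U =>
        ((-(⟨U.1.2, U.2.2⟩ : A.powDomain (1 / 2)) : A.Dom (1 / 2)),
          A.op ⟨A.incl (1 / 2) U.1.1, U.2.1⟩ + (k : 𝕜) • U.1.2)
      map_add' := by
        intro U V
        refine Prod.ext ?_ ?_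
        · exact neg_add (⟨U.1.2, U.2.2⟩ : A.powDomain (1 / 2)) ⟨V.1.2, V.2.2⟩
        · have h := A.op.map_add ⟨A.incl (1 / 2) U.1.1, U.2.1⟩ ⟨A.incl (1 / 2) V.1.1, V.2.1⟩
          change A.op (⟨A.incl (1 / 2) U.1.1, U.2.1⟩ + ⟨A.incl (1 / 2) V.1.1, V.2.1⟩) +
            (k : 𝕜) • (U.1.2 + V.1.2) = _
          rw [h, smul_add]
          exact add_add_add_comm _ _ _ _
      map_smul' := by
        intro c U
        refine Prod.ext ?_ ?_
        · exact (smul_neg c (⟨U.1.2, U.2.2⟩ : A.powDomain (1 / 2))).symm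
        · have h := A.op.map_smul c ⟨A.incl (1 / 2) U.1.1, U.2.1⟩
          change A.op (c • ⟨A.incl (1 / 2) U.1.1, U.2.1⟩) + (k : 𝕜) • (c • U.1.2) = _
          rw [h, smul_comm, ← smul_add]
          rfl }

variable [NormedSpace ℝ H]

/-- The phase space `W = C([-h,0]; D(A^{1/2})) ∩ C¹([-h,0]; H)`: an element is a function `pos`
together with its derivative `vel`, which `pos` determines. In `hasDeriv` the function `pos` is
extended by `0` outside `[-h,0]`; the derivative within `[-h,0]` does not see this extension. -/
structure PhaseSpace (h : ℝ) where
  pos : C(Icc (-h) 0, A.Dom (1 / 2))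
  vel : C(Icc (-h) 0, H)
  hasDeriv : ∀ θ : Icc (-h) 0, HasDerivWithinAt
    (fun s : ℝ => if hs : s ∈ Icc (-h) 0 then A.incl (1 / 2) (pos ⟨s, hs⟩) else 0)
    (vel θ) (Icc (-h) 0) θ

variable {A} {h : ℝ}

/-- The norm `|φ|_W = max ‖A^{1/2} φ(θ)‖ + max ‖φ̇(θ)‖`. -/
def PhaseSpace.norm (φ : PhaseSpace A h) : ℝ := ‖φ.pos‖ + ‖φ.vel‖

/-- `φ(0)`. -/
def PhaseSpace.posZero (hh : 0 < h) (φ : PhaseSpace A h) : A.Dom (1 / 2) :=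
  φ.pos ⟨0, by simpa using hh.le⟩

/-- `φ̇(0)`. -/
def PhaseSpace.velZero (hh : 0 < h) (φ : PhaseSpace A h) : H :=
  φ.vel ⟨0, by simpa using hh.le⟩

/-- The distance `|φ - ψ|_{C_0} = max_{θ ∈ [-h,0]} ‖φ(θ) - ψ(θ)‖` in `C([-h,0]; H)`. -/
def PhaseSpace.distC0 (φ ψ : PhaseSpace A h) : ℝ :=
  ⨆ θ : Icc (-h) 0, ‖A.incl (1 / 2) (φ.pos θ) - A.incl (1 / 2) (ψ.pos θ)‖

variable (A h) in
/-- The elements of `C([-h,∞); D(A^{1/2})) ∩ C¹([-h,∞); H)`: a function `pos` on `[-h,∞)` with its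
derivative `vel` (one-sided at `-h`); values at `t < -h` are irrelevant. -/
structure Trajectory where
  pos : ℝ → A.Dom (1 / 2)
  vel : ℝ → H
  cont_pos : ContinuousOn pos (Ici (-h))
  cont_vel : ContinuousOn vel (Ici (-h))
  hasDeriv : ∀ t ∈ Ici (-h),
    HasDerivWithinAt (fun s => A.incl (1 / 2) (pos s)) (vel t) (Ici (-h)) t

/-- The history segment `u_t ∈ W`, `u_t(θ) = u(t + θ)`, for `t ≥ 0`. -/
def Trajectory.segment (u : Trajectory A h) (t : ℝ≥0) : PhaseSpace A h where
  pos := ⟨fun θ => u.pos (t + θ), u.cont_pos.comp_continuous (by fun_prop) (fun θ => by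
    have := θ.2.1; have := t.2; simp only [mem_Ici]; linarith [NNReal.coe_nonneg t])⟩
  vel := ⟨fun θ => u.vel (t + θ), u.cont_vel.comp_continuous (by fun_prop) (fun θ => by
    have := θ.2.1; simp only [mem_Ici]; linarith [NNReal.coe_nonneg t])⟩
  hasDeriv := by
    intro θ
    have hm : MapsTo (fun s : ℝ => (t : ℝ) + s) (Icc (-h) 0) (Ici (-h)) := by
      intro s hs
      have := hs.1
      simp only [mem_Ici]
      linarith [NNReal.coe_nonneg t]
    have h1 := u.hasDeriv (t + θ) (hm θ.2)
    have h2 : HasDerivWithinAt (fun s : ℝ => (t : ℝ) + s) 1 (Icc (-h) 0) θ :=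
      (hasDerivWithinAt_id (θ : ℝ) _).const_add _
    have h3 := h1.scomp (θ : ℝ) h2 hm
    rw [one_smul] at h3
    refine h3.congr (fun s hs => ?_) ?_
    · simp [hs]
    · simp [θ.2]

/-- `u` is a (global) mild solution of `ü + k u̇ + A u + F(u) + M(u_t) = 0`, `u = φ` on `[-h,0]`:
with `U = (u; u̇)`,
`U(t) = e^{-t𝒜} U(0) + ∫₀ᵗ e^{-(t-s)𝒜} (0; -F(u(s)) - M(u_s)) ds` in `Y` for all `t ≥ 0`. -/
structure IsMildSolution (k : ℝ) (F : A.Dom (1 / 2) → H) (M : PhaseSpace A h → H)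
    (φ : PhaseSpace A h) (u : Trajectory A h) : Prop where
  initial : ∀ θ : Icc (-h) 0, u.pos θ = φ.pos θ
  formula : ∀ t : ℝ, 0 ≤ t →
    ((u.pos t, u.vel t) : EnergySpace A) =
      semigroupOf (-firstOrderOp A k) t (u.pos 0, u.vel 0) +
        ∫ s in (0 : ℝ)..t, semigroupOf (-firstOrderOp A k) (t - s)
          ((0, -(F (u.pos s) + M (u.segment s.toNNReal))) : EnergySpace A)

/-- `F : D(A^{1/2}) → H` is locally Lipschitz (Lipschitz on bounded sets). -/
def CondF1 (F : A.Dom (1 / 2) → H) : Prop :=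
  ∀ R > 0, ∃ L > 0, ∀ x y : A.Dom (1 / 2), ‖x‖ ≤ R → ‖y‖ ≤ R → ‖F x - F y‖ ≤ L * ‖x - y‖

/-- `F = Π' + F*` with a `C¹` functional `Π = Π₀ + Π₁` on `D(A^{1/2})` and a globally Lipschitz
`F*`. The derivative `Π'(x)` is represented in `H` through the (real part of the) inner product. -/
def CondF2 (F : A.Dom (1 / 2) → H) : Prop :=
  ∃ (Pi0 Pi1 : A.Dom (1 / 2) → ℝ) (Fstar : A.Dom (1 / 2) → H),
    ContDiff ℝ 1 (fun x => Pi0 x + Pi1 x) ∧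
    (∀ x v : A.Dom (1 / 2), fderiv ℝ (fun x => Pi0 x + Pi1 x) x v =
      RCLike.re (inner 𝕜 (F x - Fstar x) (A.incl (1 / 2) v))) ∧
    (∃ c₀ : ℝ, ∀ x y, ‖Fstar x - Fstar y‖ ^ 2 ≤ c₀ * ‖x - y‖ ^ 2) ∧
    (∀ x, 0 ≤ Pi0 x) ∧
    (∀ R : ℝ, ∃ K : ℝ, ∀ x, ‖x‖ ≤ R → Pi0 x ≤ K) ∧
    (∀ η > 0, ∃ Cη > 0, ∀ x, |Pi1 x| ≤ η * (‖x‖ ^ 2 + Pi0 x) + Cη)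

/-- `M : W → H` is Lipschitz with respect to the norm of `C([-h,0]; H)` on bounded sets of `W`. -/
def CondM1Strong (M : PhaseSpace A h → H) : Prop :=
  ∀ ρ > 0, ∃ C : ℝ, ∀ φ ψ : PhaseSpace A h, φ.norm ≤ ρ → ψ.norm ≤ ρ →
    ‖M φ - M ψ‖ ≤ C * φ.distC0 ψ

/-- `M : W → H` has linear growth. -/
def CondM2 (M : PhaseSpace A h → H) : Prop :=
  ∃ M₀ M₁ : ℝ, 0 ≤ M₀ ∧ 0 ≤ M₁ ∧ ∀ φ : PhaseSpace A h, ‖M φ‖ ≤ M₀ + M₁ * (‖φ.pos‖ + ‖φ.vel‖)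

/-- `F : D(A^{1/2}) → H` is Fréchet differentiable and for every `r` there is `C_r` such that
`‖F'(x) v‖ ≤ C_r ‖A^{1/2} v‖` whenever `x ∈ D(A)`, `‖A x‖ ≤ r`. -/
def CondFDiff (F : A.Dom (1 / 2) → H) : Prop :=
  Differentiable ℝ F ∧
  ∀ r > 0, ∃ C : ℝ, ∀ (x : A.Dom (1 / 2)) (hx : A.incl (1 / 2) x ∈ A.op.domain),
    ‖A.op ⟨A.incl (1 / 2) x, hx⟩‖ ≤ r → ∀ v : A.Dom (1 / 2), ‖fderiv ℝ F x v‖ ≤ C * ‖v‖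

variable (A) in
/-- `f ∈ L_∞(0,T; D(A^α))`: `f` agrees a.e. on `(0,T)` with an essentially bounded, strongly
measurable function into the normed space `D(A^α)`. -/
def MemLinftyDom (α T : ℝ) (f : ℝ → H) : Prop :=
  ∃ g : ℝ → A.Dom α, MemLp g ∞ (volume.restrict (Ioo 0 T)) ∧
    ∀ᵐ t ∂(volume.restrict (Ioo 0 T)), A.incl α (g t) = f t

variable (A) in
/-- `f ∈ C(ℝ₊; D(A^α))`, `ℝ₊ = [0,∞)`. -/
def ContOnDom (α : ℝ) (f : ℝ → H) : Prop :=
  ∃ g : ℝ → A.Dom α, ContinuousOn g (Ici 0) ∧ ∀ t ∈ Ici (0 : ℝ), A.incl α (g t) = f t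

/-- The derivative of `f` in the sense of `H`-valued distributions on `(0,T)` belongs to
`L_∞(0,T; H)`. -/
def DerivMemLinfty (T : ℝ) (f : ℝ → H) : Prop :=
  ∃ w : ℝ → H, MemLp w ∞ (volume.restrict (Ioo 0 T)) ∧
    ∀ ψ : ℝ → ℝ, ContDiff ℝ ∞ ψ → HasCompactSupport ψ → tsupport ψ ⊆ Ioo 0 T →
      ∫ t in Ioo 0 T, deriv ψ t • f t = - ∫ t in Ioo 0 T, ψ t • w t

/-- `f` is continuously differentiable on `ℝ₊ = [0,∞)` (one-sided derivative at `0`). -/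
def DerivContOn (f : ℝ → H) : Prop :=
  ∃ w : ℝ → H, ContinuousOn w (Ici 0) ∧ ∀ t ∈ Ici (0 : ℝ), HasDerivWithinAt f (w t) (Ici 0) t

end Delay

end

/-!
The regularity comes from the linear theory of `C₀`-semigroups, once the forcing term
`G(t) = -(F(u(t)) + M(u_t))` is known to be Lipschitz in time with values in `H`.

*The forcing term is locally Lipschitz.* A trajectory is `C¹` with values in `H`, hence the delay
term `M(u_t)`, which is Lipschitz for the norm of `C([-h,0]; H)`, is locally Lipschitz in `t`
(`CondM1Strong.exists_lipschitzOnWith`). The increments of `F(u(t))` are controlled by those of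
`U = (u; u̇)` in the energy space `Y = D(A^{1/2}) × H`. Since `U(0)` lies in the domain of the
generator, `‖U(τ) - U(0)‖ = O(τ)`, and Grönwall's inequality applied to `U(t + τ) - U(t)` shows
that `U`, and with it `G`, is locally Lipschitz (`IsMild.exists_lipschitz`).

*Lipschitz forcing gives a `C¹` solution.* The space `H` is a separable Hilbert space, so a
Lipschitz function with values in `H` is differentiable almost everywhere
(`LipschitzWith.ae_differentiableAt_of_hilbertBasis`). Dominated convergence in the difference
quotients of Duhamel's formula then gives `U ∈ C¹([0,∞); Y)`
(`IsMild.exists_hasDerivWithinAt`). The first component of `U'` is `u̇`, which is therefore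
continuous with values in `D(A^{1/2})`, and the second one is `ü`. A mild solution lies in the
domain of the generator wherever it has a right derivative, and the equation holds there
(`IsMild.mem_domain_of_tendsto_slope`); this expresses `A u` through `ü`, `u̇` and `G` and gives the
continuity of `u` in `D(A)`. Continuous functions on `[0,∞)` are bounded on `(0,T)`, which yields
the statements about `L_∞`.

*The semigroup.* The operator `-𝒜` is diagonalised into damped oscillators by the eigenbasis of `A`;
their flows are bounded uniformly in the frequency and add up to a `C₀`-semigroup with generator
`-𝒜` (`PosDiscreteOp.exists_energySemigroup`), so that `semigroupOf` is the semigroup it is meant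
to be.
-/

noncomputable section

/-! ### Lipschitz functions with values in a Hilbert space -/

section RadonNikodym

variable {𝕜 H : Type*} [RCLike 𝕜] [NormedAddCommGroup H] [InnerProductSpace 𝕜 H]
  [CompleteSpace H] [NormedSpace ℝ H]

/-- A scalar Lipschitz function is the integral of its derivative. -/
theorem LipschitzWith.integral_deriv_rclike {g : ℝ → 𝕜} {K : ℝ≥0} (hg : LipschitzWith K g)
    (x : ℝ) : ∫ t in (0 : ℝ)..x, deriv g t = g x - g 0 := by
  have hmeas : StronglyMeasurable (deriv g) := stronglyMeasurable_deriv g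
  have hb : ∀ t, ‖deriv g t‖ ≤ K := fun t => norm_deriv_le_of_lipschitz hg
  have hi : ∀ a b : ℝ, IntervalIntegrable (deriv g) volume a b := fun a b =>
    (intervalIntegrable_const (c := (K : ℝ))).mono_fun hmeas.aestronglyMeasurable
      (Eventually.of_forall fun t => by simpa using hb t)
  have hlip : LipschitzWith (K + K) (fun y => g y - ∫ t in (0 : ℝ)..y, deriv g t) := by
    refine hg.sub (LipschitzWith.of_dist_le_mul fun a b => ?_)
    rw [dist_eq_norm, intervalIntegral.integral_interval_sub_left (hi _ _) (hi _ _), Real.dist_eq]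
    exact intervalIntegral.norm_integral_le_of_norm_le_const fun t _ => hb t
  have hloc : LocallyIntegrable (deriv g) volume := fun t =>
    ⟨Icc (t - 1) (t + 1), Icc_mem_nhds (by linarith) (by linarith), by
      rw [integrableOn_Icc_iff_integrableOn_Ioc]
      exact (intervalIntegrable_iff_integrableOn_Ioc_of_le (by linarith)).1 (hi _ _)⟩
  have hzero : ∀ᵐ y, y ∈ uIcc 0 x →
      HasDerivAt (fun y => g y - ∫ t in (0 : ℝ)..y, deriv g t) 0 y := by
    filter_upwards [hg.ae_differentiableAt_real, LocallyIntegrable.ae_hasDerivAt_integral hloc]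
      with y h1 h2 _
    simpa using h1.hasDerivAt.fun_sub (h2 0)
  obtain ⟨C, hC⟩ := (hlip.lipschitzOnWith.absolutelyContinuousOnInterval
    (a := 0) (b := x)).const_of_ae_hasDerivAt_zero hzero
  have h0 := hC 0 left_mem_uIcc
  have h1 := hC x right_mem_uIcc
  rw [← h1] at h0
  simp only [intervalIntegral.integral_same, sub_zero] at h0
  rw [h0]
  abel

/-- A Lipschitz function of a real variable with values in a separable Hilbert space is
differentiable almost everywhere. The coordinates `c_j` are differentiable almost everywhere, the
bound `∑_j |c_j'|² ≤ K²` passes to the limit from the difference quotients, and the function turns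
out to be a primitive of `∑_j c_j' e_j`. -/
theorem LipschitzWith.ae_differentiableAt_of_hilbertBasis (b : HilbertBasis ℕ 𝕜 H) {g : ℝ → H}
    {K : ℝ≥0} (hg : LipschitzWith K g) : ∀ᵐ t, DifferentiableAt ℝ g t := by
  set c : ℕ → ℝ → 𝕜 := fun j t => b.repr (g t) j with hc
  have hcl : ∀ j, LipschitzWith K (c j) := fun j => LipschitzWith.of_dist_le_mul fun s t => by
    have h1 : c j s - c j t = b.repr (g s - g t) j := by simp [hc]
    rw [dist_eq_norm, h1]
    refine (lp.norm_apply_le_norm (by norm_num) _ j).trans ?_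
    rw [LinearIsometryEquiv.norm_map, ← dist_eq_norm]
    exact hg.dist_le_mul s t
  have hdiff : ∀ᵐ t, ∀ j, DifferentiableAt ℝ (c j) t :=
    ae_all_iff.2 fun j => (hcl j).ae_differentiableAt_real
  have hsum : ∀ t, (∀ j, DifferentiableAt ℝ (c j) t) → ∀ s : Finset ℕ,
      ∑ j ∈ s, ‖deriv (c j) t‖ ^ 2 ≤ (K : ℝ) ^ 2 := by
    intro t ht s
    have h1 : Tendsto (fun τ : ℝ => ∑ j ∈ s, ‖slope (c j) t τ‖ ^ 2) (𝓝[≠] t)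
        (𝓝 (∑ j ∈ s, ‖deriv (c j) t‖ ^ 2)) :=
      tendsto_finsetSum _ fun j _ =>
        ((hasDerivAt_iff_tendsto_slope.1 (ht j).hasDerivAt).norm).pow 2
    refine le_of_tendsto h1 ?_
    filter_upwards [self_mem_nhdsWithin] with τ hτ
    have hτ0 : τ - t ≠ 0 := sub_ne_zero.2 hτ
    have h2 : ∀ j, ‖slope (c j) t τ‖ ^ 2 = (|τ - t|⁻¹) ^ 2 * ‖b.repr (g τ - g t) j‖ ^ 2 := by
      intro j
      rw [slope_def_module, norm_smul, norm_inv, Real.norm_eq_abs, mul_pow]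
      simp [hc]
    simp only [h2, ← Finset.mul_sum]
    have h3 : ∑ j ∈ s, ‖b.repr (g τ - g t) j‖ ^ 2 ≤ ‖g τ - g t‖ ^ 2 := by
      have := lp.sum_rpow_le_norm_rpow (p := 2) (by norm_num) (b.repr (g τ - g t)) s
      rw [← b.repr.norm_map (g τ - g t)]
      simpa using this
    have h4 : ‖g τ - g t‖ ≤ K * |τ - t| := by
      rw [← dist_eq_norm, ← Real.dist_eq]; exact hg.dist_le_mul _ _
    have h5 : 0 < |τ - t| := abs_pos.2 hτ0
    calc (|τ - t|⁻¹) ^ 2 * ∑ j ∈ s, ‖b.repr (g τ - g t) j‖ ^ 2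
        ≤ (|τ - t|⁻¹) ^ 2 * ((K : ℝ) * |τ - t|) ^ 2 := by
          gcongr; exact h3.trans (by gcongr)
      _ = (K : ℝ) ^ 2 := by field_simp
  have hmem : ∀ t, (∀ j, DifferentiableAt ℝ (c j) t) → Memℓp (fun j => deriv (c j) t) 2 :=
    fun t ht => memℓp_gen' (C := (K : ℝ) ^ 2) fun s => by simpa using hsum t ht s
  classical
  set g' : ℝ → H := fun t => if h : Memℓp (fun j => deriv (c j) t) 2 then
    b.repr.symm ⟨_, h⟩ else 0 with hg'
  have hrepr : ∀ t, (∀ j, DifferentiableAt ℝ (c j) t) → ∀ j, b.repr (g' t) j = deriv (c j) t := by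
    intro t ht j
    simp [hg', hmem t ht]
  have hbound : ∀ t, (∀ j, DifferentiableAt ℝ (c j) t) → ‖g' t‖ ≤ K := by
    intro t ht
    rw [← b.repr.norm_map]
    refine lp.norm_le_of_forall_sum_le (by norm_num) K.2 fun s => ?_
    simpa [hrepr t ht] using hsum t ht s
  have hmeas : AEStronglyMeasurable g' volume := by
    refine aestronglyMeasurable_of_tendsto_ae atTop
      (f := fun n t => ∑ j ∈ Finset.range n, deriv (c j) t • b j) (fun n => ?_) ?_
    · refine (Finset.aestronglyMeasurable_fun_sum _ fun j _ => ?_)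
      exact (stronglyMeasurable_deriv (c j)).aestronglyMeasurable.smul_const _
    · filter_upwards [hdiff] with t ht
      have := (b.hasSum_repr (g' t)).tendsto_sum_nat
      simpa only [hrepr t ht] using this
  have hi : ∀ x y : ℝ, IntervalIntegrable g' volume x y := fun x y =>
    (intervalIntegrable_const (c := (K : ℝ))).mono_fun hmeas.restrict <| ae_restrict_of_ae <| by
      filter_upwards [hdiff] with t ht
      simpa using hbound t ht
  have hloc : LocallyIntegrable g' volume := fun t =>
    ⟨Icc (t - 1) (t + 1), Icc_mem_nhds (by linarith) (by linarith), by
      rw [integrableOn_Icc_iff_integrableOn_Ioc]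
      exact (intervalIntegrable_iff_integrableOn_Ioc_of_le (by linarith)).1 (hi _ _)⟩
  have hprim : ∀ x, g x = g 0 + ∫ t in (0 : ℝ)..x, g' t := by
    intro x
    rw [← sub_eq_iff_eq_add']
    apply b.repr.injective
    ext j
    have h1 : b.repr (∫ t in (0 : ℝ)..x, g' t) j = ∫ t in (0 : ℝ)..x, b.repr (g' t) j := by
      simp only [b.repr_apply_apply]
      exact ((innerSL 𝕜 (b j)).intervalIntegral_comp_comm (hi 0 x)).symm
    rw [h1, intervalIntegral.integral_congr_ae (g := fun t => deriv (c j) t) (by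
      filter_upwards [hdiff] with t ht _ using hrepr t ht j), (hcl j).integral_deriv_rclike x]
    simp [hc]
  filter_upwards [LocallyIntegrable.ae_hasDerivAt_integral hloc] with t ht
  exact (((ht 0).const_add (g 0)).congr_of_eventuallyEq (.of_forall hprim)).differentiableAt

/-- The local form of `LipschitzWith.ae_differentiableAt_of_hilbertBasis`. -/
theorem ae_differentiableAt_of_lipschitzOnWith (b : HilbertBasis ℕ 𝕜 H) {g : ℝ → H}
    (hg : ∀ T : ℝ, ∃ K : ℝ≥0, LipschitzOnWith K g (Icc (-T) T)) :
    ∀ᵐ t, DifferentiableAt ℝ g t := by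
  have key : ∀ n : ℕ, ∀ᵐ t, |t| < (n : ℝ) → DifferentiableAt ℝ g t := by
    intro n
    obtain ⟨K, hK⟩ := hg n
    have hn : -(n : ℝ) ≤ n := by linarith [n.cast_nonneg (α := ℝ)]
    have h1 : LipschitzWith (K * 1) (g ∘ fun t => (projIcc (-(n : ℝ)) n hn t : ℝ)) := by
      have h2 : LipschitzWith 1 (fun t => (projIcc (-(n : ℝ)) n hn t : ℝ)) :=
        LipschitzWith.of_dist_le_mul fun x y => (LipschitzWith.projIcc hn).dist_le_mul x y
      exact lipschitzOnWith_univ.1 (hK.comp h2.lipschitzOnWith fun t _ => (projIcc _ _ hn t).2)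
    filter_upwards [h1.ae_differentiableAt_of_hilbertBasis b] with t ht htn
    refine ht.congr_of_eventuallyEq ?_
    filter_upwards [Ioo_mem_nhds (abs_lt.1 htn).1 (abs_lt.1 htn).2] with s hs
    simp [projIcc_of_mem hn (Ioo_subset_Icc_self hs)]
  filter_upwards [ae_all_iff.2 key] with t ht
  obtain ⟨n, hn⟩ := exists_nat_gt |t|
  exact ht n hn

end RadonNikodym

/-! ### `C₀`-semigroups and mild solutions -/

section AbstractSemigroup

variable {𝕜 Y : Type*} [RCLike 𝕜] [NormedAddCommGroup Y] [NormedSpace 𝕜 Y]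
  {S : ℝ → Y →L[𝕜] Y}

theorem IsC0Semigroup.add_apply (hS : IsC0Semigroup S) {s t : ℝ} (hs : 0 ≤ s) (ht : 0 ≤ t)
    (y : Y) : S (s + t) y = S s (S t y) := by
  rw [hS.add s t hs ht]; rfl

variable [CompleteSpace Y]

/-- A `C₀`-semigroup is bounded near `0`: otherwise some `‖S (t_n)‖ → ∞` with `t_n ↓ 0`, against
the uniform boundedness principle. -/
theorem IsC0Semigroup.exists_bound_near_zero (hS : IsC0Semigroup S) :
    ∃ δ > 0, ∃ C : ℝ, ∀ t ∈ Icc 0 δ, ‖S t‖ ≤ C := by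
  by_contra! hcon
  have h1 : ∀ n : ℕ, ∃ t ∈ Icc (0 : ℝ) (1 / ((n : ℝ) + 1)), (n : ℝ) < ‖S t‖ :=
    fun n => hcon _ (by positivity) n
  choose t ht hlt using h1
  have ht0 : Tendsto t atTop (𝓝 0) :=
    squeeze_zero (fun n => (ht n).1) (fun n => (ht n).2) tendsto_one_div_add_atTop_nhds_zero_nat
  have hpt : ∀ y, ∃ C, ∀ n, ‖S (t n) y‖ ≤ C := by
    intro y
    have h0 : ContinuousWithinAt (fun s => S s y) (Ici 0) 0 := by
      rw [← continuousWithinAt_Ioi_iff_Ici]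
      simpa [ContinuousWithinAt, hS.zero] using hS.tendsto y
    have h2 : Tendsto (fun n => S (t n) y) atTop (𝓝 (S 0 y)) :=
      h0.tendsto.comp (tendsto_nhdsWithin_iff.2 ⟨ht0, .of_forall fun n => (ht n).1⟩)
    obtain ⟨C, hC⟩ := h2.norm.bddAbove_range
    exact ⟨C, fun n => hC ⟨n, rfl⟩⟩
  obtain ⟨C, hC⟩ := banach_steinhaus hpt
  obtain ⟨n, hn⟩ := exists_nat_gt C
  exact absurd (hC n) (not_le.2 (hn.trans (hlt n)))

theorem IsC0Semigroup.exists_bound (hS : IsC0Semigroup S) (T : ℝ) :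
    ∃ C > 0, ∀ t ∈ Icc 0 T, ‖S t‖ ≤ C := by
  obtain ⟨δ, hδ, C, hC⟩ := hS.exists_bound_near_zero
  have key : ∀ n : ℕ, ∀ t ∈ Icc 0 (n * δ), ‖S t‖ ≤ (max C 1) ^ n * max C 1 := by
    intro n
    induction n with
    | zero =>
      intro t ht
      simpa using Or.inl (hC t ⟨ht.1, by have := ht.2; simp at this; linarith⟩)
    | succ n ih =>
      intro t ht
      rcases le_total t δ with h | h
      · calc ‖S t‖ ≤ max C 1 := (hC t ⟨ht.1, h⟩).trans (le_max_left _ _)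
          _ ≤ _ := le_mul_of_one_le_left (by positivity) (one_le_pow₀ (le_max_right _ _))
      · have h2 : S t = (S δ).comp (S (t - δ)) := by
          rw [← hS.add _ _ hδ.le (sub_nonneg.2 h)]; congr 1; ring
        have h3 := ih (t - δ) ⟨sub_nonneg.2 h, by
          have := ht.2; push_cast at this; linarith⟩
        calc ‖S t‖ ≤ ‖S δ‖ * ‖S (t - δ)‖ := by rw [h2]; exact ContinuousLinearMap.opNorm_comp_le _ _
          _ ≤ max C 1 * ((max C 1) ^ n * max C 1) := by
            gcongr
            exact (hC δ ⟨hδ.le, le_rfl⟩).trans (le_max_left _ _)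
          _ = _ := by ring
  obtain ⟨n, hn⟩ := exists_nat_ge (T / δ)
  refine ⟨(max C 1) ^ n * max C 1, by positivity, fun t ht => key n t ⟨ht.1, ht.2.trans ?_⟩⟩
  rwa [div_le_iff₀ hδ] at hn

theorem IsC0Semigroup.continuousOn_apply (hS : IsC0Semigroup S) (y : Y) :
    ContinuousOn (fun t => S t y) (Ici 0) := by
  have h0 : ContinuousWithinAt (fun s => S s y) (Ici 0) 0 := by
    rw [← continuousWithinAt_Ioi_iff_Ici]
    simpa [ContinuousWithinAt, hS.zero] using hS.tendsto y
  intro t ht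
  obtain ⟨C, hC0, hC⟩ := hS.exists_bound (t + 1)
  have hmin : ∀ s : ℝ, 0 ≤ s → s ≤ t + 1 →
      ‖S s y - S t y‖ ≤ C * ‖S |s - t| y - y‖ := by
    have aux : ∀ a b : ℝ, 0 ≤ a → a ≤ t + 1 → a ≤ b → ‖S b y - S a y‖ ≤ C * ‖S (b - a) y - y‖ := by
      intro a b ha hat hab
      have h1 : S b y = S a (S (b - a) y) := by
        rw [← hS.add_apply ha (sub_nonneg.2 hab)]; congr 2; ring
      rw [h1, ← map_sub]
      exact ((S a).le_opNorm _).trans (by gcongr; exact hC a ⟨ha, hat⟩)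
    intro s hs hst
    rcases le_total s t with h | h
    · rw [norm_sub_rev, abs_sub_comm, abs_of_nonneg (sub_nonneg.2 h)]
      exact aux s t hs hst h
    · rw [abs_of_nonneg (sub_nonneg.2 h)]
      exact aux t s ht (by linarith) h
  rw [ContinuousWithinAt, tendsto_iff_norm_sub_tendsto_zero]
  have hlim : Tendsto (fun s => C * ‖S |s - t| y - y‖) (𝓝[Ici 0] t) (𝓝 0) := by
    have h1 : Tendsto (fun s => |s - t|) (𝓝[Ici 0] t) (𝓝[Ici 0] 0) := by
      refine tendsto_nhdsWithin_iff.2 ⟨?_, .of_forall fun s => mem_Ici.2 (abs_nonneg _)⟩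
      have : Continuous fun s : ℝ => |s - t| := by fun_prop
      simpa using (this.tendsto t).mono_left nhdsWithin_le_nhds
    have h2 := (h0.tendsto.comp h1)
    simpa [hS.zero] using ((h2.sub_const y).norm.const_mul C)
  refine squeeze_zero' (.of_forall fun s => norm_nonneg _) ?_ hlim
  filter_upwards [self_mem_nhdsWithin, mem_nhdsWithin_of_mem_nhds (Iio_mem_nhds (lt_add_one t))]
    with s hs hst
  exact hmin s hs (le_of_lt hst)

/-- Strong continuity and local boundedness make `(t, y) ↦ S t y` jointly continuous on
`[0,∞) × Y`; the truncation `max t 0` extends this to all real `t`. -/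
theorem IsC0Semigroup.continuous_uncurry (hS : IsC0Semigroup S) :
    Continuous fun p : ℝ × Y => S (max p.1 0) p.2 := by
  rw [continuous_iff_continuousAt]
  rintro ⟨t, y⟩
  obtain ⟨C, hC0, hC⟩ := hS.exists_bound (max t 0 + 1)
  have h1 : Continuous fun s : ℝ => S (max s 0) y :=
    (hS.continuousOn_apply y).comp_continuous (by fun_prop) fun s => mem_Ici.2 (le_max_right _ _)
  rw [ContinuousAt, tendsto_iff_norm_sub_tendsto_zero]
  have hlim : Tendsto (fun p : ℝ × Y => C * ‖p.2 - y‖ + ‖S (max p.1 0) y - S (max t 0) y‖)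
      (𝓝 (t, y)) (𝓝 0) := by
    have h2 : Continuous fun p : ℝ × Y => C * ‖p.2 - y‖ + ‖S (max p.1 0) y - S (max t 0) y‖ := by
      have := h1.comp (continuous_fst (X := ℝ) (Y := Y))
      exact (continuous_const.mul (continuous_snd.sub continuous_const).norm).add
        (this.sub continuous_const).norm
    simpa using h2.tendsto (t, y)
  refine squeeze_zero' (.of_forall fun s => norm_nonneg _) ?_ hlim
  have h3 : ∀ᶠ p : ℝ × Y in 𝓝 (t, y), p.1 < t + 1 :=
    (continuous_fst.tendsto (t, y)).eventually (Iio_mem_nhds (lt_add_one t))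
  filter_upwards [h3] with p hp
  have h4 : S (max p.1 0) p.2 - S (max t 0) y =
      S (max p.1 0) (p.2 - y) + (S (max p.1 0) y - S (max t 0) y) := by rw [map_sub]; abel
  rw [h4]
  refine (norm_add_le _ _).trans (add_le_add_left ?_ _)
  refine ((S _).le_opNorm _).trans ?_
  gcongr
  refine hC _ ⟨le_max_right _ _, max_le ?_ ?_⟩
  · exact hp.le.trans (by gcongr; exact le_max_left _ _)
  · have := le_max_right t 0; linarith

theorem IsC0Semigroup.continuous_integrand (hS : IsC0Semigroup S) {f : ℝ → Y}
    (hf : Continuous f) (t r : ℝ) :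
    Continuous fun s => S (max (t - s) 0) (f (s + r)) :=
  hS.continuous_uncurry.comp (f := fun s => (t - s, f (s + r))) (by fun_prop)

end AbstractSemigroup

section MildSolution

variable {𝕜 Y : Type*} [RCLike 𝕜] [NormedAddCommGroup Y] [NormedSpace 𝕜 Y] [NormedSpace ℝ Y]
  {S : ℝ → Y →L[𝕜] Y} {L : Y →ₗ.[𝕜] Y} {f U : ℝ → Y}

/-- `S (t - s) (f s)` may be replaced by a continuous integrand in the integral over `[0,t]`. -/
theorem convolution_eq_max (f : ℝ → Y) {t : ℝ} (ht : 0 ≤ t) :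
    ∫ s in (0 : ℝ)..t, S (t - s) (f s) = ∫ s in (0 : ℝ)..t, S (max (t - s) 0) (f s) := by
  refine intervalIntegral.integral_congr fun s hs => ?_
  rw [uIcc_of_le ht] at hs
  rw [max_eq_left (by linarith [hs.2])]

/-- `U` is a mild solution of `U' = L U + f`, where `L` generates `S`. -/
def IsMild (S : ℝ → Y →L[𝕜] Y) (f U : ℝ → Y) : Prop :=
  ∀ t, 0 ≤ t → U t = S t (U 0) + ∫ s in (0 : ℝ)..t, S (t - s) (f s)

variable [CompleteSpace Y]

theorem IsMild.continuousOn (hU : IsMild S f U) (hS : IsC0Semigroup S) (hf : Continuous f) :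
    ContinuousOn U (Ici 0) := by
  have h1 : Continuous fun t : ℝ => ∫ s in (0 : ℝ)..t, S (max (t - s) 0) (f s) := by
    refine intervalIntegral.continuous_parametric_intervalIntegral_of_continuous
      (f := fun t s => S (max (t - s) 0) (f s)) ?_ continuous_id
    exact hS.continuous_uncurry.comp (f := fun p : ℝ × ℝ => (p.1 - p.2, f p.2)) (by fun_prop)
  refine ((hS.continuousOn_apply (U 0)).add h1.continuousOn).congr fun t ht => ?_
  rw [hU t ht, convolution_eq_max f ht]
  rfl

/-- A mild solution restarted at time `τ` is a mild solution. -/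
theorem IsMild.shift (hU : IsMild S f U) (hS : IsC0Semigroup S) (hf : Continuous f) {τ : ℝ}
    (hτ : 0 ≤ τ) : IsMild S (fun s => f (s + τ)) (fun t => U (t + τ)) := by
  intro t ht
  simp only [zero_add]
  have hi : ∀ a b : ℝ, IntervalIntegrable (fun s => S (max (t + τ - s) 0) (f s)) volume a b :=
    fun a b => by simpa using (hS.continuous_integrand hf (t + τ) 0).intervalIntegrable a b
  have hi2 : IntervalIntegrable (fun s => S (max (τ - s) 0) (f s)) volume 0 τ := by
    simpa using (hS.continuous_integrand hf τ 0).intervalIntegrable 0 τ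
  have h1 : S t (∫ s in (0 : ℝ)..τ, S (max (τ - s) 0) (f s)) =
      ∫ s in (0 : ℝ)..τ, S (max (t + τ - s) 0) (f s) := by
    rw [← (S t).intervalIntegral_comp_comm hi2]
    refine intervalIntegral.integral_congr fun s hs => ?_
    rw [uIcc_of_le hτ] at hs
    have h0 : 0 ≤ τ - s := by linarith [hs.2]
    rw [max_eq_left h0, max_eq_left (by linarith), ← hS.add_apply ht h0]
    congr 2; ring
  have h2 : ∫ s in (0 : ℝ)..t, S (max (t - s) 0) (f (s + τ)) =
      ∫ s in τ..(t + τ), S (max (t + τ - s) 0) (f s) := by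
    have := intervalIntegral.integral_comp_add_right (a := 0) (b := t)
      (fun s => S (max (t + τ - s) 0) (f s)) τ
    rw [zero_add] at this
    rw [← this]
    refine intervalIntegral.integral_congr fun s _ => ?_
    simp
  rw [hU (t + τ) (by linarith), hU τ hτ, convolution_eq_max f hτ,
    convolution_eq_max f (by linarith : 0 ≤ t + τ),
    convolution_eq_max (fun s => f (s + τ)) ht, h2, map_add, h1,
    ← hS.add_apply ht hτ, add_assoc,
    intervalIntegral.integral_add_adjacent_intervals (hi _ _) (hi _ _)]

theorem IsMild.shift_sub (hU : IsMild S f U) (hS : IsC0Semigroup S) (hf : Continuous f) {τ t : ℝ}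
    (hτ : 0 ≤ τ) (ht : 0 ≤ t) : U (t + τ) - U t =
      S t (U τ - U 0) + ∫ s in (0 : ℝ)..t, S (t - s) (f (s + τ) - f s) := by
  have h1 := hU.shift hS hf hτ t ht
  simp only [zero_add] at h1
  have hi1 := (hS.continuous_integrand hf t τ).intervalIntegrable (μ := volume) 0 t
  have hi2 : IntervalIntegrable (fun s => S (max (t - s) 0) (f s)) volume 0 t := by
    simpa using (hS.continuous_integrand hf t 0).intervalIntegrable 0 t
  rw [h1, hU t ht, convolution_eq_max _ ht, convolution_eq_max f ht,
    convolution_eq_max (fun s => f (s + τ) - f s) ht]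
  simp only [map_sub]
  rw [intervalIntegral.integral_sub hi1 hi2]
  abel

theorem IsC0Semigroup.tendsto_average (hS : IsC0Semigroup S) (hf : Continuous f) :
    Tendsto (fun τ : ℝ => τ⁻¹ • ∫ s in (0 : ℝ)..τ, S (τ - s) (f s)) (𝓝[>] 0) (𝓝 (f 0)) := by
  have h1 : Continuous fun τ : ℝ => ∫ r in (0 : ℝ)..1, S (max (τ - τ * r) 0) (f (τ * r)) := by
    refine intervalIntegral.continuous_parametric_intervalIntegral_of_continuous
      (f := fun τ r => S (max (τ - τ * r) 0) (f (τ * r))) ?_ continuous_const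
    exact hS.continuous_uncurry.comp
      (f := fun p : ℝ × ℝ => (p.1 - p.1 * p.2, f (p.1 * p.2))) (by fun_prop)
  have h2 := (h1.tendsto 0).mono_left (nhdsWithin_le_nhds (s := Ioi 0))
  simp only [zero_mul, sub_zero, max_self, hS.zero, ContinuousLinearMap.id_apply,
    intervalIntegral.integral_const, one_smul] at h2
  refine h2.congr' ?_
  filter_upwards [self_mem_nhdsWithin] with τ hτ
  have hτ' : τ ≠ 0 := ne_of_gt hτ
  have h3 := intervalIntegral.integral_comp_mul_left (a := 0) (b := 1)
    (fun s => S (max (τ - s) 0) (f s)) hτ'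
  rw [mul_zero, mul_one] at h3
  rw [h3, convolution_eq_max f (le_of_lt hτ)]

/-- A mild solution that starts in the domain of the generator has a right derivative at `0`. -/
theorem IsMild.tendsto_slope_zero (hU : IsMild S f U) (hS : IsC0Semigroup S)
    (hL : IsGenerator S L) (hf : Continuous f) (h0 : U 0 ∈ L.domain) :
    Tendsto (fun τ : ℝ => τ⁻¹ • (U τ - U 0)) (𝓝[>] 0) (𝓝 (L ⟨U 0, h0⟩ + f 0)) := by
  refine (((hL _ _).1 ⟨h0, rfl⟩).add (hS.tendsto_average hf)).congr' ?_
  filter_upwards [self_mem_nhdsWithin] with τ hτ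
  rw [hU τ (le_of_lt hτ), ← smul_add]
  congr 1; abel

/-- Conversely, where a mild solution has a right derivative it lies in the domain of the
generator, and the equation holds. -/
theorem IsMild.mem_domain_of_tendsto_slope (hU : IsMild S f U) (hS : IsC0Semigroup S)
    (hL : IsGenerator S L) (hf : Continuous f) {t : ℝ} (ht : 0 ≤ t) {z : Y}
    (hz : Tendsto (fun τ : ℝ => τ⁻¹ • (U (t + τ) - U t)) (𝓝[>] 0) (𝓝 z)) :
    ∃ h : U t ∈ L.domain, L ⟨U t, h⟩ = z - f t := by
  refine (hL _ _).2 ?_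
  have h1 := hS.tendsto_average (f := fun s => f (s + t)) (by fun_prop)
  simp only [zero_add] at h1
  refine (hz.sub h1).congr' ?_
  filter_upwards [self_mem_nhdsWithin] with τ hτ
  have h2 := hU.shift hS hf ht τ (le_of_lt hτ)
  simp only [zero_add] at h2
  rw [add_comm t τ, h2, ← smul_sub]
  congr 1; abel

end MildSolution

/-! ### Regularity of mild solutions -/

section Regularity

variable {𝕜 Y : Type*} [RCLike 𝕜] [NormedAddCommGroup Y] [NormedSpace 𝕜 Y] [NormedSpace ℝ Y]
  {S : ℝ → Y →L[𝕜] Y} {L : Y →ₗ.[𝕜] Y} {f U : ℝ → Y}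

/-- The integral form of Grönwall's inequality. -/
theorem le_gronwallBound_of_le_integral {n : ℝ → ℝ} {δ K ε T : ℝ} (hK : 0 ≤ K)
    (hn : Continuous n)
    (h : ∀ t ∈ Icc 0 T, n t ≤ δ + ∫ s in (0 : ℝ)..t, (K * n s + ε)) :
    ∀ t ∈ Icc 0 T, n t ≤ gronwallBound δ K ε t := by
  have hc : Continuous fun s => K * n s + ε := by fun_prop
  have hd : ∀ x, HasDerivAt (fun t => δ + ∫ s in (0 : ℝ)..t, (K * n s + ε)) (K * n x + ε) x :=
    fun x => (hc.integral_hasStrictDerivAt 0 x).hasDerivAt.const_add δ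
  intro t ht
  refine (h t ht).trans ?_
  have := le_gronwallBound_of_liminf_deriv_right_le (a := 0) (b := T) (δ := δ) (K := K) (ε := ε)
    (f := fun t => δ + ∫ s in (0 : ℝ)..t, (K * n s + ε)) (f' := fun x => K * n x + ε)
    (fun x _ => (hd x).continuousAt.continuousWithinAt)
    (fun x _ r hr => (hd x).hasDerivWithinAt.liminf_right_slope_le hr) (by simp)
    (fun x hx => by have := h x ⟨hx.1, hx.2.le⟩; gcongr) t ht
  simpa using this

/-- A function on `[0,T]` that has a right derivative at `0` satisfies a Lipschitz estimate from
the point `0`. -/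
theorem exists_norm_sub_zero_le (hU : ContinuousOn U (Ici 0)) {z : Y}
    (hz : Tendsto (fun τ : ℝ => τ⁻¹ • (U τ - U 0)) (𝓝[>] 0) (𝓝 z)) (T : ℝ) :
    ∃ K, 0 ≤ K ∧ ∀ τ ∈ Icc 0 T, ‖U τ - U 0‖ ≤ K * τ := by
  set q : ℝ → Y := Function.update (fun τ : ℝ => τ⁻¹ • (U τ - U 0)) 0 z with hq
  have hqc : ContinuousOn q (Icc 0 T) := by
    rw [hq, continuousOn_update_iff]
    constructor
    · refine ContinuousOn.smul (continuousOn_id.inv₀ fun x hx => hx.2) ?_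
      exact (hU.mono fun x hx => hx.1.1).sub continuousOn_const
    · intro _
      refine hz.mono_left (nhdsWithin_mono _ fun x hx => ?_)
      exact lt_of_le_of_ne hx.1.1 (Ne.symm hx.2)
  obtain ⟨C, hC⟩ := isCompact_Icc.exists_bound_of_continuousOn hqc
  refine ⟨max C 0, le_max_right _ _, fun τ hτ => ?_⟩
  rcases hτ.1.eq_or_lt with h0 | h0
  · simp [← h0]
  · have h1 := hC τ hτ
    rw [hq, Function.update_of_ne h0.ne', norm_smul, norm_inv, Real.norm_of_nonneg h0.le,
      inv_mul_le_iff₀ h0] at h1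
    rw [mul_comm]
    exact h1.trans (by gcongr; exact le_max_left _ _)

variable [CompleteSpace Y]

/-- A mild solution that starts in the domain of the generator is locally Lipschitz in time, when
the increments of the forcing term are controlled by those of the solution up to a Lipschitz
error. -/
theorem IsMild.exists_lipschitz (hU : IsMild S f U) (hS : IsC0Semigroup S)
    (hL : IsGenerator S L) (hf : Continuous f) (h0 : U 0 ∈ L.domain)
    (hinc : ∀ T > 0, ∃ a b : ℝ, 0 ≤ a ∧ 0 ≤ b ∧ ∀ s τ, 0 ≤ s → 0 ≤ τ → s + τ ≤ T →
      ‖f (s + τ) - f s‖ ≤ a * ‖U (s + τ) - U s‖ + b * τ) {T : ℝ} (hT : 0 < T) :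
    ∃ K, 0 ≤ K ∧ ∀ s τ, 0 ≤ s → 0 ≤ τ → s + τ ≤ T → ‖U (s + τ) - U s‖ ≤ K * τ := by
  obtain ⟨a, b, ha, hb, hinc⟩ := hinc T hT
  obtain ⟨C, hC0, hC⟩ := hS.exists_bound T
  have hUc := hU.continuousOn hS hf
  obtain ⟨K₀, hK0, hK⟩ := exists_norm_sub_zero_le hUc (hU.tendsto_slope_zero hS hL hf h0) T
  have hg := gronwallBound_mono (δ := C * K₀) (ε := C * b) (K := C * a) (by positivity)
    (by positivity) (by positivity)
  have hg0 := hg hT.le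
  rw [gronwallBound_x0] at hg0
  refine ⟨gronwallBound (C * K₀) (C * a) (C * b) T, (by positivity : 0 ≤ C * K₀).trans hg0,
    fun t τ ht hτ htτ => ?_⟩
  -- For a fixed step `τ`, Grönwall's inequality is applied to `s ↦ ‖U (s + τ) - U s‖`.
  set n : ℝ → ℝ := fun s => ‖U (max s 0 + τ) - U (max s 0)‖ with hn
  have hnc : Continuous n := by
    refine Continuous.norm (Continuous.sub ?_ ?_)
    · exact hUc.comp_continuous (by fun_prop) fun s =>
        mem_Ici.2 (add_nonneg (le_max_right _ _) hτ)
    · exact hUc.comp_continuous (by fun_prop) fun s => mem_Ici.2 (le_max_right _ _)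
  have hmain : ∀ r ∈ Icc 0 (T - τ), n r ≤ C * K₀ * τ + ∫ s in (0 : ℝ)..r,
      (C * a * n s + C * b * τ) := by
    intro r hr
    have h1 : ‖∫ s in (0 : ℝ)..r, S (r - s) (f (s + τ) - f s)‖ ≤
        ∫ s in (0 : ℝ)..r, (C * a * n s + C * b * τ) := by
      refine intervalIntegral.norm_integral_le_of_norm_le hr.1 (.of_forall fun s hs => ?_)
        ((by fun_prop : Continuous fun s => C * a * n s + C * b * τ).intervalIntegrable _ _)
      have h2 : ‖S (r - s)‖ ≤ C := hC _ ⟨by linarith [hs.2], by linarith [hs.1, hr.2]⟩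
      have h3 := hinc s τ hs.1.le hτ (by linarith [hs.2, hr.2])
      calc ‖S (r - s) (f (s + τ) - f s)‖ ≤ C * ‖f (s + τ) - f s‖ :=
            ((S _).le_opNorm _).trans (by gcongr)
        _ ≤ C * (a * ‖U (s + τ) - U s‖ + b * τ) := by gcongr
        _ = C * a * n s + C * b * τ := by simp only [hn, max_eq_left hs.1.le]; ring
    have h4 : ‖S r (U τ - U 0)‖ ≤ C * K₀ * τ := by
      have h5 : ‖S r‖ ≤ C := hC r ⟨hr.1, by linarith [hr.2]⟩
      have h6 := hK τ ⟨hτ, by linarith⟩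
      calc ‖S r (U τ - U 0)‖ ≤ C * (K₀ * τ) := ((S _).le_opNorm _).trans (by gcongr)
        _ = _ := by ring
    simp only [hn, max_eq_left hr.1]
    rw [hU.shift_sub hS hf hτ hr.1]
    exact (norm_add_le _ _).trans (add_le_add h4 h1)
  have h7 := le_gronwallBound_of_le_integral (by positivity) hnc hmain t ⟨ht, by linarith⟩
  simp only [hn, max_eq_left ht] at h7
  -- The bound is homogeneous in the initial value and the error, hence linear in `τ`.
  have h8 : gronwallBound (C * K₀ * τ) (C * a) (C * b * τ) t =
      gronwallBound (C * K₀) (C * a) (C * b) t * τ := by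
    simp only [gronwallBound]
    split_ifs <;> ring
  rw [h8] at h7
  refine h7.trans ?_
  gcongr
  exact hg (by linarith)

/-- If the forcing term is locally Lipschitz and differentiable almost everywhere, then a mild
solution starting in the domain of the generator is continuously differentiable: its derivative
is the mild solution of the differentiated problem. Dominated convergence gives the right
derivative, and a continuous function with continuous right derivative is `C¹`. -/
theorem IsMild.exists_hasDerivWithinAt (hU : IsMild S f U) (hS : IsC0Semigroup S)
    (hL : IsGenerator S L) (h0 : U 0 ∈ L.domain)
    (hlip : ∀ T : ℝ, ∃ K : ℝ≥0, LipschitzOnWith K f (Icc (-T) T))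
    (hdiff : ∀ᵐ t, DifferentiableAt ℝ f t) :
    ∃ Z : ℝ → Y, ContinuousOn Z (Ici 0) ∧ ∀ t ∈ Ici (0 : ℝ),
      HasDerivWithinAt U (Z t) (Ici 0) t := by
  have hf : Continuous f := by
    rw [continuous_iff_continuousAt]
    intro t
    obtain ⟨K, hK⟩ := hlip (|t| + 1)
    exact hK.continuousOn.continuousAt
      (Icc_mem_nhds (by linarith [neg_abs_le t]) (by linarith [le_abs_self t]))
  have hUc := hU.continuousOn hS hf
  set y₀ : Y := L ⟨U 0, h0⟩ + f 0 with hy₀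
  set J : ℝ → Y := fun t => ∫ s in (0 : ℝ)..t, S (max (t - s) 0) (deriv f s) with hJ
  set Z : ℝ → Y := fun t => S (max t 0) y₀ + J t with hZ
  have hmeas : ∀ t, AEStronglyMeasurable (fun s => S (max (t - s) 0) (deriv f s)) volume :=
    fun t => hS.continuous_uncurry.comp_aestronglyMeasurable (f := fun s => (t - s, deriv f s))
      ((by fun_prop : Continuous fun s : ℝ => t - s).aestronglyMeasurable.prodMk
        (stronglyMeasurable_deriv f).aestronglyMeasurable)
  have hJc : Continuous J := by
    rw [continuous_iff_continuousAt]
    intro t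
    obtain ⟨K, hK⟩ := hlip (|t| + 1)
    obtain ⟨C, hC0, hC⟩ := hS.exists_bound (2 * |t| + 2)
    have h1 := intervalIntegral.continuousAt_parametric_primitive_of_dominated (μ := volume)
      (F := fun t s => S (max (t - s) 0) (deriv f s)) (fun _ => C * K) (-(|t| + 1)) (|t| + 1)
      (a₀ := 0) (b₀ := t) (x₀ := t) (fun x => (hmeas x).restrict) ?_
      intervalIntegrable_const ?_ ⟨by linarith [abs_nonneg t], by linarith [abs_nonneg t]⟩
      ⟨by linarith [neg_abs_le t], by linarith [le_abs_self t]⟩ (by simp)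
    · exact h1.comp (f := fun x : ℝ => (x, x)) (by fun_prop)
    · filter_upwards [Iio_mem_nhds (lt_add_one t)] with x hx
      rw [uIoc_of_le (by linarith [abs_nonneg t]), ← restrict_Ioo_eq_restrict_Ioc]
      filter_upwards [ae_restrict_mem measurableSet_Ioo] with s hs
      have h2 : ‖deriv f s‖ ≤ K := norm_deriv_le_of_lipschitzOn (Icc_mem_nhds hs.1 hs.2) hK
      have h3 : ‖S (max (x - s) 0)‖ ≤ C := hC _ ⟨le_max_right _ _, max_le
        (by linarith [mem_Iio.1 hx, le_abs_self t, hs.1]) (by positivity)⟩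
      exact ((S _).le_opNorm _).trans (by gcongr)
    · refine .of_forall fun s => Continuous.continuousAt ?_
      exact hS.continuous_uncurry.comp (f := fun x : ℝ => (x - s, deriv f s)) (by fun_prop)
  have hZc : Continuous Z := by
    refine Continuous.add ?_ hJc
    exact hS.continuous_uncurry.comp (f := fun x : ℝ => (x, y₀)) (by fun_prop)
  -- Apply Duhamel's formula to `U (t + τ) - U t`, divide by `τ` and let `τ` tend to `0`.
  have hright : ∀ t, 0 ≤ t → HasDerivWithinAt U (Z t) (Ici t) t := by
    intro t ht
    have hslope : Tendsto (fun τ : ℝ => τ⁻¹ • (U (t + τ) - U t)) (𝓝[>] 0) (𝓝 (Z t)) := by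
      obtain ⟨K, hK⟩ := hlip (t + 1)
      obtain ⟨C, hC0, hC⟩ := hS.exists_bound t
      have h1 : Tendsto (fun τ : ℝ => S t (τ⁻¹ • (U τ - U 0))) (𝓝[>] 0) (𝓝 (S (max t 0) y₀)) := by
        rw [max_eq_left ht]
        exact ((S t).continuous.tendsto _).comp (hU.tendsto_slope_zero hS hL hf h0)
      have h2 : Tendsto
          (fun τ : ℝ => ∫ s in (0 : ℝ)..t, S (max (t - s) 0) (τ⁻¹ • (f (s + τ) - f s)))
          (𝓝[>] 0) (𝓝 (J t)) := by
        refine intervalIntegral.tendsto_integral_filter_of_dominated_convergence (fun _ => C * K)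
          (.of_forall fun τ => ?_) ?_ intervalIntegrable_const ?_
        · exact (hS.continuous_uncurry.comp (f := fun s : ℝ => (t - s, τ⁻¹ • (f (s + τ) - f s)))
            (by fun_prop)).aestronglyMeasurable
        · filter_upwards [Ioo_mem_nhdsGT (zero_lt_one' ℝ)] with τ hτ
          refine .of_forall fun s hs => ?_
          rw [uIoc_of_le ht] at hs
          have h3 : ‖S (max (t - s) 0)‖ ≤ C := hC _ ⟨le_max_right _ _, max_le
            (by linarith [hs.1]) ht⟩
          have h4 : ‖τ⁻¹ • (f (s + τ) - f s)‖ ≤ K := by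
            rw [norm_smul, norm_inv, Real.norm_of_nonneg hτ.1.le, inv_mul_le_iff₀ hτ.1]
            have := hK.dist_le_mul (s + τ) ⟨by linarith [hs.1, hτ.1], by linarith [hs.2, hτ.2]⟩ s
              ⟨by linarith [hs.1], by linarith [hs.2]⟩
            rw [dist_eq_norm, Real.dist_eq, add_sub_cancel_left, abs_of_pos hτ.1] at this
            linarith
          exact ((S _).le_opNorm _).trans (by gcongr)
        · filter_upwards [hdiff] with s hs _
          have h5 := hs.hasDerivAt.tendsto_slope_zero_right
          exact ((S _).continuous.tendsto _).comp h5
      refine (h1.add h2).congr' ?_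
      filter_upwards [self_mem_nhdsWithin] with τ hτ
      rw [hU.shift_sub hS hf (le_of_lt hτ) ht, smul_add, map_real_smul (S t) (S t).continuous,
        convolution_eq_max _ ht, ← intervalIntegral.integral_smul]
      congr 1
      exact intervalIntegral.integral_congr fun s _ => map_real_smul (S _) (S _).continuous _ _
    rw [← hasDerivWithinAt_Ioi_iff_Ici, hasDerivWithinAt_iff_tendsto_slope' self_notMem_Ioi]
    have h6 : Tendsto (fun x => x - t) (𝓝[>] t) (𝓝[>] 0) := by
      refine tendsto_nhdsWithin_iff.2 ⟨?_, ?_⟩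
      · have : Continuous fun x : ℝ => x - t := by fun_prop
        simpa using (this.tendsto t).mono_left nhdsWithin_le_nhds
      · filter_upwards [self_mem_nhdsWithin] with x hx
        simpa using hx
    refine (hslope.comp h6).congr fun x => ?_
    simp [slope_def_module]
  have hprim : ∀ x, HasDerivAt (fun t => U 0 + ∫ s in (0 : ℝ)..t, Z s) (Z x) x :=
    fun x => (hZc.integral_hasStrictDerivAt 0 x).hasDerivAt.const_add _
  have heq : ∀ t, 0 ≤ t → U t = U 0 + ∫ s in (0 : ℝ)..t, Z s := by
    intro t ht
    exact eq_of_has_deriv_right_eq (fun x hx => hright x hx.1)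
      (fun x _ => (hprim x).hasDerivWithinAt) (hUc.mono fun x hx => mem_Ici.2 hx.1)
      (fun x _ => (hprim x).continuousAt.continuousWithinAt) (by simp) t ⟨ht, le_rfl⟩
  exact ⟨Z, hZc.continuousOn, fun t ht =>
    (hprim t).hasDerivWithinAt.congr (fun s hs => heq s hs) (heq t ht)⟩

end Regularity

/-! ### Domains of powers, function spaces, and the delay term -/

section Domains

namespace PosDiscreteOp

variable {𝕜 H : Type*} [RCLike 𝕜] [NormedAddCommGroup H] [InnerProductSpace 𝕜 H]
  [CompleteSpace H] (A : PosDiscreteOp 𝕜 H)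

theorem isometry_domPow (α : ℝ) : Isometry (A.domPow α) :=
  AddMonoidHomClass.isometry_of_norm (A.domPow α) fun _ => rfl

/-- For `α ≥ 0` the powers `μ_k^α` are bounded below by `μ_0^α > 0`, so that `A^α` is onto `H`. -/
theorem domPow_surjective {α : ℝ} (hα : 0 ≤ α) : Function.Surjective (A.domPow α) := by
  intro y
  have hpos : ∀ k, 0 < A.eig k ^ α := fun k => Real.rpow_pos_of_pos (A.eig_pos k) α
  have hmem : Memℓp (fun k => (((A.eig k ^ α)⁻¹ : ℝ) : 𝕜) • (A.basis.repr y k : 𝕜)) 2 := by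
    refine ((lp.memℓp (A.basis.repr y)).const_smul (((A.eig 0 ^ α)⁻¹ : ℝ) : 𝕜)).mono' fun k => ?_
    rw [Pi.smul_apply, norm_smul, norm_smul, RCLike.norm_ofReal, RCLike.norm_ofReal,
      abs_of_pos (inv_pos.2 (hpos k)), abs_of_pos (inv_pos.2 (hpos 0))]
    gcongr
    · exact hpos 0
    · exact (A.eig_pos 0).le
    · exact A.eig_mono (Nat.zero_le k)
  set x : H := A.basis.repr.symm ⟨_, hmem⟩ with hx
  have hcoord : ∀ k, ((A.eig k ^ α : ℝ) : 𝕜) • (A.basis.repr x k : 𝕜) = A.basis.repr y k := by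
    intro k
    have : ((A.eig k ^ α : ℝ) : 𝕜) ≠ 0 := by exact_mod_cast (hpos k).ne'
    rw [hx, LinearIsometryEquiv.apply_symm_apply]
    simp [this]
  have hxm : x ∈ A.powDomain α := by
    change Memℓp (fun k => ((A.eig k ^ α : ℝ) : 𝕜) • (A.basis.repr x k : 𝕜)) 2
    simp only [hcoord]
    exact lp.memℓp _
  refine ⟨(⟨x, hxm⟩ : A.powDomain α), ?_⟩
  apply A.basis.repr.injective
  ext k
  exact (A.repr_apow α ⟨x, hxm⟩ k).trans (hcoord k)

theorem completeSpace_dom {α : ℝ} (hα : 0 ≤ α) : CompleteSpace (A.Dom α) :=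
  (completeSpace_congr (e := Equiv.ofBijective (A.domPow α)
    ⟨A.apow_injective α, A.domPow_surjective hα⟩) (A.isometry_domPow α).isUniformEmbedding).2
    inferInstance

end PosDiscreteOp

end Domains

section FunctionSpaces

variable {𝕜 H : Type*} [RCLike 𝕜] [NormedAddCommGroup H] [InnerProductSpace 𝕜 H]
  [CompleteSpace H] {A : PosDiscreteOp 𝕜 H}

theorem ContinuousOn.memLp_top_restrict_Ioo {E : Type*} [NormedAddCommGroup E] {g : ℝ → E}
    (hg : ContinuousOn g (Ici 0)) (T : ℝ) : MemLp g ∞ (volume.restrict (Ioo 0 T)) := by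
  obtain ⟨C, hC⟩ := isCompact_Icc.exists_bound_of_continuousOn
    (hg.mono fun x (hx : x ∈ Icc 0 T) => mem_Ici.2 hx.1)
  refine memLp_top_of_bound ?_ C ?_
  · exact (hg.mono fun x hx => mem_Ici.2 (le_of_lt hx.1)).aestronglyMeasurable measurableSet_Ioo
  · filter_upwards [ae_restrict_mem measurableSet_Ioo] with t ht
    exact hC t (Ioo_subset_Icc_self ht)

theorem CondF1.continuous {F : A.Dom (1 / 2) → H} (hF : CondF1 F) : Continuous F := by
  rw [continuous_iff_continuousAt]
  intro x
  obtain ⟨K, hK0, hK⟩ := hF (‖x‖ + 1) (by positivity)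
  have hL : LipschitzOnWith K.toNNReal F (Metric.closedBall 0 (‖x‖ + 1)) :=
    LipschitzOnWith.of_dist_le_mul fun y hy z hz => by
      rw [Real.coe_toNNReal _ hK0.le, dist_eq_norm, dist_eq_norm]
      exact hK y z (by simpa using hy) (by simpa using hz)
  exact hL.continuousOn.continuousAt
    (Metric.closedBall_mem_nhds_of_mem (by simp))

theorem ContOnDom.memLinftyDom {α : ℝ} {f : ℝ → H} (hf : ContOnDom A α f) (T : ℝ) :
    MemLinftyDom A α T f := by
  obtain ⟨g, hg, hgf⟩ := hf
  refine ⟨g, hg.memLp_top_restrict_Ioo T, ?_⟩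
  filter_upwards [ae_restrict_mem measurableSet_Ioo] with t ht
  exact hgf t (mem_Ici.2 ht.1.le)

/-- A classical derivative is a distributional one, by integration by parts. -/
theorem DerivContOn.derivMemLinfty {E : Type*} [NormedAddCommGroup E] [NormedSpace ℝ E]
    [CompleteSpace E] {f : ℝ → E} (hf : DerivContOn f) {T : ℝ} (hT : 0 < T) :
    DerivMemLinfty T f := by
  obtain ⟨w, hw, hd⟩ := hf
  refine ⟨w, hw.memLp_top_restrict_Ioo T, fun ψ hψ _ hsupp => ?_⟩
  have hfc : ContinuousOn f (Ici 0) := fun t ht => (hd t ht).continuousWithinAt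
  have hsub : uIcc 0 T ⊆ Ici 0 := by
    rw [uIcc_of_le hT.le]; exact fun x hx => mem_Ici.2 hx.1
  have hψd : ∀ t, HasDerivAt ψ (deriv ψ t) t := fun t =>
    (hψ.differentiable (by simp) t).hasDerivAt
  have hψ' : Continuous (deriv ψ) := hψ.continuous_deriv (by simp)
  have hz : ∀ t, t ∉ Ioo 0 T → ψ t = 0 := fun t ht =>
    image_eq_zero_of_notMem_tsupport fun h => ht (hsupp h)
  have h1 : IntervalIntegrable (fun t => deriv ψ t • f t) volume 0 T :=
    ((hψ'.continuousOn.smul hfc).mono hsub).intervalIntegrable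
  have h2 : IntervalIntegrable (fun t => ψ t • w t) volume 0 T :=
    ((hψ.continuous.continuousOn.smul hw).mono hsub).intervalIntegrable
  have h3 : ∫ t in (0 : ℝ)..T, (ψ t • w t + deriv ψ t • f t) = ψ T • f T - ψ 0 • f 0 := by
    refine intervalIntegral.integral_eq_sub_of_hasDeriv_right_of_le hT.le
      ((hψ.continuous.continuousOn.smul hfc).mono fun x hx => mem_Ici.2 hx.1)
      (fun t ht => ?_) (h2.add h1)
    exact (hψd t).hasDerivWithinAt.smul
      ((hd t (mem_Ici.2 ht.1.le)).mono fun x hx => mem_Ici.2 (ht.1.trans hx).le)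
  rw [hz T (by simp), hz 0 (by simp), zero_smul, zero_smul, sub_zero,
    intervalIntegral.integral_add h2 h1] at h3
  rw [← integral_Ioc_eq_integral_Ioo, ← integral_Ioc_eq_integral_Ioo,
    ← intervalIntegral.integral_of_le hT.le, ← intervalIntegral.integral_of_le hT.le]
  exact eq_neg_of_add_eq_zero_right h3

/-- Since the norm of `D(A)` is `‖A ·‖`, continuity in `D(A)` is continuity of `A f`. -/
theorem ContOnDom.of_op {f w : ℝ → H} (hw : ContinuousOn w (Ici 0))
    (hf : ∀ t ∈ Ici (0 : ℝ), ∃ h : f t ∈ A.op.domain, A.op ⟨f t, h⟩ = w t) : ContOnDom A 1 f := by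
  have hg : ∀ t, ∃ x : A.Dom 1, t ∈ Ici (0 : ℝ) → A.incl 1 x = f t ∧ A.domPow 1 x = w t := by
    intro t
    by_cases ht : t ∈ Ici (0 : ℝ)
    · obtain ⟨h, hop⟩ := hf t ht
      have hx : f t ∈ A.powDomain 1 := A.mem_powDomain_one.2 h
      exact ⟨(⟨f t, hx⟩ : A.powDomain 1), fun _ => ⟨rfl, (A.apow_one ⟨f t, hx⟩).trans hop⟩⟩
    · exact ⟨0, fun h => absurd h ht⟩
  choose g hg using hg
  refine ⟨g, ?_, fun t ht => (hg t ht).1⟩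
  rw [(A.isometry_domPow 1).isUniformInducing.isInducing.continuousOn_iff]
  exact hw.congr fun t ht => (hg t ht).2

/-- The equation `-𝒜 U = z`, component by component. -/
theorem firstOrderOp_neg_apply_eq {k : ℝ} {U z : EnergySpace A}
    (hU : ∃ h : U ∈ (-firstOrderOp A k).domain, (-firstOrderOp A k) ⟨U, h⟩ = z) :
    (∃ h : A.incl (1 / 2) U.1 ∈ A.op.domain,
      A.op ⟨A.incl (1 / 2) U.1, h⟩ = -z.2 - (k : 𝕜) • U.2) ∧ A.incl (1 / 2) z.1 = U.2 := by
  obtain ⟨hd, rfl⟩ := hU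
  refine ⟨⟨hd.1, ?_⟩, ?_⟩
  · change _ = -(-(A.op ⟨A.incl (1 / 2) U.1, hd.1⟩ + (k : 𝕜) • U.2)) - (k : 𝕜) • U.2
    abel
  · change ((-(-(⟨U.2, hd.2⟩ : A.powDomain (1 / 2))) : A.powDomain (1 / 2)) : H) = U.2
    simp

end FunctionSpaces

section DelayTerm

variable {𝕜 H : Type*} [RCLike 𝕜] [NormedAddCommGroup H] [InnerProductSpace 𝕜 H]
  [CompleteSpace H] [NormedSpace ℝ H] {A : PosDiscreteOp 𝕜 H} {h : ℝ}

theorem Trajectory.norm_incl_sub_le (u : Trajectory A h) {V T : ℝ}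
    (hV : ∀ t ∈ Icc (-h) T, ‖u.vel t‖ ≤ V) {s t : ℝ} (hs : s ∈ Icc (-h) T) (ht : t ∈ Icc (-h) T) :
    ‖A.incl (1 / 2) (u.pos t) - A.incl (1 / 2) (u.pos s)‖ ≤ V * |t - s| :=
  (convex_Icc (-h) T).norm_image_sub_le_of_norm_hasDerivWithin_le
    (fun x hx => (u.hasDeriv x hx.1).mono fun _ hy => hy.1) hV hs ht

/-- The delay term `t ↦ M(u_t)` is locally Lipschitz along a trajectory, because the trajectory is
`C¹` with values in `H` and `M` is Lipschitz for the norm of `C([-h,0]; H)`. -/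
theorem CondM1Strong.exists_lipschitzOnWith {M : PhaseSpace A h → H} (hM : CondM1Strong M)
    (hh : 0 < h) (u : Trajectory A h) (T : ℝ) :
    ∃ K : ℝ≥0, LipschitzOnWith K (fun s : ℝ => M (u.segment s.toNNReal)) (Icc (-T) T) := by
  obtain ⟨P, hP⟩ := (isCompact_Icc (a := -h) (b := T)).exists_bound_of_continuousOn
    (u.cont_pos.mono fun x hx => hx.1)
  obtain ⟨V, hV⟩ := (isCompact_Icc (a := -h) (b := T)).exists_bound_of_continuousOn
    (u.cont_vel.mono fun x hx => hx.1)
  obtain ⟨C, hC⟩ := hM (|P| + |V| + 1) (by positivity)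
  have hne : Nonempty (Icc (-h) (0 : ℝ)) := ⟨⟨0, by simpa using hh.le⟩⟩
  have hmem : ∀ s ∈ Icc (-T) T, ∀ θ : Icc (-h) (0 : ℝ), max s 0 + θ ∈ Icc (-h) T := by
    intro s hs θ
    have hT : 0 ≤ T := by linarith [hs.1, hs.2]
    exact ⟨by linarith [θ.2.1, le_max_right s 0], by linarith [θ.2.2, max_le hs.2 hT]⟩
  have hnorm : ∀ s ∈ Icc (-T) T, (u.segment s.toNNReal).norm ≤ |P| + |V| + 1 := by
    intro s hs
    have h1 : ‖(u.segment s.toNNReal).pos‖ ≤ |P| :=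
      (ContinuousMap.norm_le _ (abs_nonneg P)).2 fun θ =>
        (hP _ (hmem s hs θ)).trans (le_abs_self P)
    have h2 : ‖(u.segment s.toNNReal).vel‖ ≤ |V| :=
      (ContinuousMap.norm_le _ (abs_nonneg V)).2 fun θ =>
        (hV _ (hmem s hs θ)).trans (le_abs_self V)
    unfold PhaseSpace.norm
    linarith
  refine ⟨Real.toNNReal (|C| * |V|), LipschitzOnWith.of_dist_le_mul fun s hs t ht => ?_⟩
  rw [Real.coe_toNNReal _ (by positivity), dist_eq_norm, Real.dist_eq]
  have hdist : (u.segment s.toNNReal).distC0 (u.segment t.toNNReal) ≤ |V| * |s - t| := by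
    refine ciSup_le fun θ => ?_
    refine (u.norm_incl_sub_le hV (hmem t ht θ) (hmem s hs θ)).trans ?_
    rw [add_sub_add_right_eq_sub]
    exact mul_le_mul (le_abs_self V) (abs_max_sub_max_le_abs s t 0) (abs_nonneg _) (abs_nonneg _)
  have hdist0 : 0 ≤ (u.segment s.toNNReal).distC0 (u.segment t.toNNReal) :=
    Real.iSup_nonneg fun θ => norm_nonneg _
  calc _ ≤ C * (u.segment s.toNNReal).distC0 (u.segment t.toNNReal) :=
        hC _ _ (hnorm s hs) (hnorm t ht)
    _ ≤ |C| * (|V| * |s - t|) := by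
        gcongr
        exact le_abs_self C
    _ = _ := by ring

/-- The velocity at time `0` of a trajectory with initial datum `φ`. -/
theorem Trajectory.vel_zero_eq (hh : 0 < h) (u : Trajectory A h) {φ : PhaseSpace A h}
    (hu : ∀ θ : Icc (-h) 0, u.pos θ = φ.pos θ) : u.vel 0 = φ.velZero hh := by
  have h0 : (0 : ℝ) ∈ Icc (-h) 0 := ⟨by linarith, le_rfl⟩
  have h1 := (u.hasDeriv 0 (by simpa using hh.le)).mono (fun x hx => hx.1 : Icc (-h) 0 ⊆ Ici (-h))
  have h2 : HasDerivWithinAt (fun s => A.incl (1 / 2) (u.pos s)) (φ.velZero hh) (Icc (-h) 0) 0 := by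
    refine (φ.hasDeriv ⟨0, h0⟩).congr (fun s hs => ?_) ?_
    · simp only [hs, dif_pos, hu ⟨s, hs⟩]
    · simp only [h0, dif_pos, ← hu ⟨0, h0⟩]
  exact (uniqueDiffOn_Icc (by linarith : -h < 0) 0 h0).eq_deriv _ h1 h2

end DelayTerm

section MildToStrong

variable {𝕜 H : Type*} [RCLike 𝕜] [NormedAddCommGroup H] [InnerProductSpace 𝕜 H]
  [CompleteSpace H] [NormedSpace ℝ H] {A : PosDiscreteOp 𝕜 H} {h k : ℝ}

theorem hasDerivWithinAt_prod_snd {E G : Type*} [NormedAddCommGroup E] [NormedAddCommGroup G]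
    [NormedSpace ℝ E] [NormedSpace ℝ G] {U : ℝ → E × G} {z : E × G} {s : Set ℝ} {t : ℝ}
    (hU : HasDerivWithinAt U z s t) : HasDerivWithinAt (fun t => (U t).2) z.2 s t :=
  (ContinuousLinearMap.snd ℝ E G).hasFDerivAt.comp_hasDerivWithinAt t hU

/-- If `-𝒜` generates a `C₀`-semigroup, then a mild solution with initial data in `D(𝒜)` is a
strong solution: in the energy space it is continuously differentiable. -/
theorem IsMildSolution.contOnDom {F : A.Dom (1 / 2) → H} {M : PhaseSpace A h → H} (hh : 0 < h)
    (hS : IsC0Semigroup (semigroupOf (-firstOrderOp A k)))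
    (hL : IsGenerator (semigroupOf (-firstOrderOp A k)) (-firstOrderOp A k))
    (hF : CondF1 F) (hM : CondM1Strong M) {φ : PhaseSpace A h}
    (hφ0 : A.incl (1 / 2) (φ.posZero hh) ∈ A.op.domain)
    (hφ1 : φ.velZero hh ∈ A.powDomain (1 / 2))
    {u : Trajectory A h} (hu : IsMildSolution k F M φ u) :
    ContOnDom A 1 (fun t => A.incl (1 / 2) (u.pos t)) ∧ ContOnDom A (1 / 2) u.vel ∧
      DerivContOn u.vel := by
  have := A.completeSpace_dom (α := 1 / 2) (by norm_num)
  -- The forcing term, extended to `t < 0` by its value at `0`.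
  set G : ℝ → H := fun s => -(F (u.pos (max s 0)) + M (u.segment s.toNNReal)) with hG
  set f : ℝ → EnergySpace A := fun s => (0, G s) with hf
  set U : ℝ → EnergySpace A := fun t => (u.pos t, u.vel t) with hU
  have hpos : ContinuousOn u.pos (Ici 0) := u.cont_pos.mono fun x hx => by
    simp only [mem_Ici] at hx ⊢; linarith
  have hmaxc : Continuous fun s => u.pos (max s 0) :=
    hpos.comp_continuous (by fun_prop) fun s => mem_Ici.2 (le_max_right _ _)
  have hMc : Continuous fun s : ℝ => M (u.segment s.toNNReal) := by
    rw [continuous_iff_continuousAt]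
    intro t
    obtain ⟨K, hK⟩ := hM.exists_lipschitzOnWith hh u (|t| + 1)
    exact hK.continuousOn.continuousAt
      (Icc_mem_nhds (by linarith [neg_abs_le t]) (by linarith [le_abs_self t]))
  have hGc : Continuous G := ((hF.continuous.comp hmaxc).add hMc).neg
  have hfc : Continuous f := continuous_const.prodMk hGc
  have hfG : ∀ s t, ‖f s - f t‖ = ‖G s - G t‖ := fun s t => by simp [hf, Prod.norm_def]
  have hmild : IsMild (semigroupOf (-firstOrderOp A k)) f U := by
    intro t ht
    refine (hu.formula t ht).trans ?_
    congr 1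
    refine intervalIntegral.integral_congr fun s hs => ?_
    rw [uIcc_of_le ht] at hs
    simp only [hf, hG, max_eq_left hs.1]
  have hmem : (0 : ℝ) ∈ Icc (-h) 0 := ⟨by linarith, le_rfl⟩
  have h0 : U 0 ∈ (-firstOrderOp A k).domain := by
    refine ⟨?_, ?_⟩
    · change A.incl (1 / 2) (u.pos 0) ∈ A.op.domain
      rw [hu.initial ⟨0, hmem⟩]
      exact hφ0
    · change u.vel 0 ∈ A.powDomain (1 / 2)
      rw [u.vel_zero_eq hh hu.initial]
      exact hφ1
  -- Increments of the forcing term: (F1) for `F`, the Lipschitz bound in `t` for the delay term.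
  have hGinc : ∀ T > 0, ∃ a b : ℝ, 0 ≤ a ∧ 0 ≤ b ∧ ∀ s t, s ∈ Icc (-T) T → t ∈ Icc (-T) T →
      ‖G t - G s‖ ≤ a * ‖u.pos (max t 0) - u.pos (max s 0)‖ + b * |t - s| := by
    intro T hT
    obtain ⟨R, hR⟩ := isCompact_Icc.exists_bound_of_continuousOn
      (hmaxc.continuousOn (s := Icc (-T) T))
    obtain ⟨a, ha, hFa⟩ := hF (|R| + 1) (by positivity)
    obtain ⟨b, hb⟩ := hM.exists_lipschitzOnWith hh u T
    refine ⟨a, b, ha.le, b.2, fun s t hs ht => ?_⟩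
    have h1 : ∀ r ∈ Icc (-T) T, ‖u.pos (max r 0)‖ ≤ |R| + 1 := fun r hr =>
      (hR r hr).trans (by linarith [le_abs_self R])
    have h2 := hFa _ _ (h1 t ht) (h1 s hs)
    have h3 := hb.dist_le_mul t ht s hs
    rw [dist_eq_norm, Real.dist_eq] at h3
    have h4 : G t - G s = -((F (u.pos (max t 0)) - F (u.pos (max s 0))) +
        (M (u.segment t.toNNReal) - M (u.segment s.toNNReal))) := by
      simp only [hG]; abel
    rw [h4, norm_neg]
    exact (norm_add_le _ _).trans (add_le_add h2 h3)
  have hUpos : ∀ s t, ‖u.pos t - u.pos s‖ ≤ ‖U t - U s‖ := fun s t =>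
    norm_fst_le (U t - U s)
  have hinc : ∀ T > 0, ∃ a b : ℝ, 0 ≤ a ∧ 0 ≤ b ∧ ∀ s τ, 0 ≤ s → 0 ≤ τ → s + τ ≤ T →
      ‖f (s + τ) - f s‖ ≤ a * ‖U (s + τ) - U s‖ + b * τ := by
    intro T hT
    obtain ⟨a, b, ha, hb, hab⟩ := hGinc T hT
    refine ⟨a, b, ha, hb, fun s τ hs hτ hsτ => ?_⟩
    have h1 := hab s (s + τ) ⟨by linarith, by linarith⟩ ⟨by linarith, hsτ⟩
    rw [max_eq_left hs, max_eq_left (by linarith), add_sub_cancel_left, abs_of_nonneg hτ] at h1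
    rw [hfG]
    exact h1.trans (by gcongr; exact hUpos _ _)
  have hGlip : ∀ T : ℝ, ∃ K : ℝ≥0, LipschitzOnWith K G (Icc (-T) T) := by
    intro T
    rcases le_or_gt T 0 with hT | hT
    · refine ⟨0, LipschitzOnWith.of_dist_le_mul fun s hs t ht => ?_⟩
      have : s = t := by linarith [hs.1, hs.2, ht.1, ht.2]
      simp [this]
    obtain ⟨a, b, ha, hb, hab⟩ := hGinc T hT
    obtain ⟨K, hK0, hK⟩ := hmild.exists_lipschitz hS hL hfc h0 hinc hT
    have hKle : ∀ s t, 0 ≤ s → s ≤ t → t ≤ T → ‖u.pos t - u.pos s‖ ≤ K * |t - s| := by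
      intro s t hs hst ht
      have := hK s (t - s) hs (by linarith) (by linarith)
      rw [add_sub_cancel] at this
      rw [abs_of_nonneg (sub_nonneg.2 hst)]
      exact (hUpos s t).trans this
    refine ⟨Real.toNNReal (a * K + b), LipschitzOnWith.of_dist_le_mul fun t ht s hs => ?_⟩
    rw [Real.coe_toNNReal _ (by positivity), dist_eq_norm, Real.dist_eq]
    have h1 : ‖u.pos (max t 0) - u.pos (max s 0)‖ ≤ K * |max t 0 - max s 0| := by
      rcases le_total (max s 0) (max t 0) with hle | hle
      · exact hKle _ _ (le_max_right _ _) hle (max_le ht.2 hT.le)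
      · rw [norm_sub_rev, abs_sub_comm]
        exact hKle _ _ (le_max_right _ _) hle (max_le hs.2 hT.le)
    have h2 : |max t 0 - max s 0| ≤ |t - s| := abs_max_sub_max_le_abs t s 0
    calc ‖G t - G s‖ ≤ a * ‖u.pos (max t 0) - u.pos (max s 0)‖ + b * |t - s| := hab s t hs ht
      _ ≤ a * (K * |t - s|) + b * |t - s| := by
        gcongr
        exact h1.trans (by gcongr)
      _ = _ := by ring
  have hflip : ∀ T : ℝ, ∃ K : ℝ≥0, LipschitzOnWith K f (Icc (-T) T) := by
    intro T
    obtain ⟨K, hK⟩ := hGlip T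
    refine ⟨K, LipschitzOnWith.of_dist_le_mul fun s hs t ht => ?_⟩
    rw [dist_eq_norm, hfG, ← dist_eq_norm]
    exact hK.dist_le_mul s hs t ht
  have hfdiff : ∀ᵐ t, DifferentiableAt ℝ f t := by
    filter_upwards [ae_differentiableAt_of_lipschitzOnWith A.basis hGlip] with t ht
    exact (differentiableAt_const _).prodMk ht
  obtain ⟨Z, hZc, hZ⟩ := hmild.exists_hasDerivWithinAt hS hL h0 hflip hfdiff
  have hstrong : ∀ t ∈ Ici (0 : ℝ), ∃ hd : U t ∈ (-firstOrderOp A k).domain,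
      (-firstOrderOp A k) ⟨U t, hd⟩ = Z t - f t := by
    intro t ht
    refine hmild.mem_domain_of_tendsto_slope hS hL hfc ht ?_
    have h1 := ((hZ t ht).mono (Ici_subset_Ici.2 ht)).Ioi_of_Ici
    rw [hasDerivWithinAt_iff_tendsto_slope' self_notMem_Ioi] at h1
    have h2 : Tendsto (fun τ : ℝ => t + τ) (𝓝[>] 0) (𝓝[>] t) := by
      refine tendsto_nhdsWithin_iff.2 ⟨?_, ?_⟩
      · have : Continuous fun x : ℝ => t + x := by fun_prop
        simpa using (this.tendsto 0).mono_left nhdsWithin_le_nhds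
      · filter_upwards [self_mem_nhdsWithin] with x hx
        simpa using hx
    refine (h1.comp h2).congr fun τ => ?_
    simp [slope_def_module]
  have hvel : ContinuousOn u.vel (Ici 0) := u.cont_vel.mono fun x hx => by
    simp only [mem_Ici] at hx ⊢; linarith
  refine ⟨.of_op (w := fun t => -((Z t).2 - G t) - (k : 𝕜) • u.vel t) ?_
      fun t ht => (firstOrderOp_neg_apply_eq (hstrong t ht)).1,
    ⟨fun t => (Z t).1, hZc.fst, fun t ht => ?_⟩,
    fun t => (Z t).2, hZc.snd, fun t ht => hasDerivWithinAt_prod_snd (hZ t ht)⟩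
  · exact (hZc.snd.sub hGc.continuousOn).neg.sub (hvel.const_smul (k : 𝕜))
  · simpa [hf] using (firstOrderOp_neg_apply_eq (hstrong t ht)).2

end MildToStrong

/-! ### Damped oscillators and diagonal operators -/

section Modes

/-- The fundamental matrix `[[p, q], [r, s]]` of the damped oscillator `x' = ν y`,
`y' = -ν x - k y`. -/
structure IsOscillatorFlow (ν k : ℝ) (p q r s : ℝ → ℝ) : Prop where
  p_zero : p 0 = 1
  q_zero : q 0 = 0
  r_zero : r 0 = 0
  s_zero : s 0 = 1
  p_deriv : ∀ t, HasDerivAt p (ν * r t) t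
  q_deriv : ∀ t, HasDerivAt q (ν * s t) t
  r_deriv : ∀ t, HasDerivAt r (-(ν * p t) - k * r t) t
  s_deriv : ∀ t, HasDerivAt s (-(ν * q t) - k * s t) t
  p_add : ∀ t τ, p (t + τ) = p t * p τ + q t * r τ
  q_add : ∀ t τ, q (t + τ) = p t * q τ + q t * s τ
  r_add : ∀ t τ, r (t + τ) = r t * p τ + s t * r τ
  s_add : ∀ t τ, s (t + τ) = r t * q τ + s t * s τ

theorem exists_isOscillatorFlow (ν k : ℝ) : ∃ p q r s : ℝ → ℝ, IsOscillatorFlow ν k p q r s := by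
  set B : ℝ × ℝ →L[ℝ] ℝ × ℝ := (ν • ContinuousLinearMap.snd ℝ ℝ ℝ).prod
    (-(ν • ContinuousLinearMap.fst ℝ ℝ ℝ) - k • ContinuousLinearMap.snd ℝ ℝ ℝ) with hB
  set E : ℝ → ℝ × ℝ →L[ℝ] ℝ × ℝ := fun t => NormedSpace.exp (t • B) with hE
  have hd : ∀ t v, HasDerivAt (fun t => E t v) (B (E t v)) t := fun t v =>
    ((ContinuousLinearMap.apply ℝ (ℝ × ℝ) v).hasFDerivAt.comp_hasDerivAt t
      (hasDerivAt_exp_smul_const' (𝕂 := ℝ) B t))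
  have hd1 : ∀ t v, HasDerivAt (fun t => (E t v).1) (B (E t v)).1 t := fun t v =>
    (ContinuousLinearMap.fst ℝ ℝ ℝ).hasFDerivAt.comp_hasDerivAt t (hd t v)
  have hd2 : ∀ t v, HasDerivAt (fun t => (E t v).2) (B (E t v)).2 t := fun t v =>
    (ContinuousLinearMap.snd ℝ ℝ ℝ).hasFDerivAt.comp_hasDerivAt t (hd t v)
  have h0 : E 0 = 1 := by simp [hE]
  have hadd : ∀ t τ v, E (t + τ) v = E t (E τ v) := by
    intro t τ v
    have : E (t + τ) = E t * E τ := by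
      let _ : NormedAlgebra ℚ (ℝ × ℝ →L[ℝ] ℝ × ℝ) := NormedAlgebra.restrictScalars ℚ ℝ _
      simp only [hE, add_smul]
      exact NormedSpace.exp_add_of_commute (((Commute.refl B).smul_left t).smul_right τ)
    rw [this]; rfl
  have hlin : ∀ t (v : ℝ × ℝ), E t v = v.1 • E t (1, 0) + v.2 • E t (0, 1) := by
    intro t v
    rw [← map_smul, ← map_smul, ← map_add]
    congr 1
    ext <;> simp
  refine ⟨fun t => (E t (1, 0)).1, fun t => (E t (0, 1)).1, fun t => (E t (1, 0)).2,
    fun t => (E t (0, 1)).2, ⟨by simp [h0], by simp [h0], by simp [h0], by simp [h0],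
    fun t => by simpa [hB] using hd1 t (1, 0), fun t => by simpa [hB] using hd1 t (0, 1),
    fun t => by simpa [hB] using hd2 t (1, 0), fun t => by simpa [hB] using hd2 t (0, 1),
    fun t τ => ?_, fun t τ => ?_, fun t τ => ?_, fun t τ => ?_⟩⟩ <;>
  · simp only [hadd]
    rw [hlin t (E τ _)]
    simp
    ring

/-- The energy `x² + y²` of a solution of `x' = ν y`, `y' = -ν x - k y` grows at most like
`e^{2|k|t}`, whatever the frequency `ν`. -/
theorem oscillator_sq_le {ν k : ℝ} {x y : ℝ → ℝ} (hx : ∀ t, HasDerivAt x (ν * y t) t)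
    (hy : ∀ t, HasDerivAt y (-(ν * x t) - k * y t) t) (h0 : x 0 ^ 2 + y 0 ^ 2 = 1)
    {t : ℝ} (ht : 0 ≤ t) : x t ^ 2 + y t ^ 2 ≤ Real.exp (|k| * t) ^ 2 := by
  have hd : ∀ t, HasDerivAt (fun t => x t ^ 2 + y t ^ 2)
      (2 * x t * (ν * y t) + 2 * y t * (-(ν * x t) - k * y t)) t := by
    intro t
    exact (((hx t).fun_pow 2).fun_add ((hy t).fun_pow 2)).congr_deriv (by norm_num)
  have h1 := le_gronwallBound_of_liminf_deriv_right_le (a := 0) (b := t) (δ := 1) (K := 2 * |k|)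
    (ε := 0) (f := fun t => x t ^ 2 + y t ^ 2)
    (f' := fun t => 2 * x t * (ν * y t) + 2 * y t * (-(ν * x t) - k * y t))
    (fun z _ => (hd z).continuousAt.continuousWithinAt)
    (fun z _ r hr => (hd z).hasDerivWithinAt.liminf_right_slope_le hr) h0.le
    (fun z _ => by
      have h2 : -k * y z ^ 2 ≤ |k| * y z ^ 2 := by gcongr; exact neg_le_abs k
      have h3 : 0 ≤ |k| * x z ^ 2 := by positivity
      linarith) t ⟨ht, le_rfl⟩
  rw [gronwallBound_ε0, one_mul, sub_zero] at h1
  refine h1.trans (le_of_eq ?_)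
  rw [← Real.exp_nat_mul]
  congr 1
  push_cast; ring

namespace IsOscillatorFlow

variable {ν k : ℝ} {p q r s : ℝ → ℝ}

/-- The entries of the flow are bounded uniformly in the frequency. -/
theorem abs_le (h : IsOscillatorFlow ν k p q r s) {t : ℝ} (ht : 0 ≤ t) :
    |p t| ≤ Real.exp (|k| * t) ∧ |q t| ≤ Real.exp (|k| * t) ∧
    |r t| ≤ Real.exp (|k| * t) ∧ |s t| ≤ Real.exp (|k| * t) := by
  have h1 := oscillator_sq_le h.p_deriv h.r_deriv (by simp [h.p_zero, h.r_zero]) ht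
  have h2 := oscillator_sq_le h.q_deriv h.s_deriv (by simp [h.q_zero, h.s_zero]) ht
  have he := (Real.exp_pos (|k| * t)).le
  exact ⟨abs_le_of_sq_le_sq (by nlinarith [sq_nonneg (r t)]) he,
    abs_le_of_sq_le_sq (by nlinarith [sq_nonneg (s t)]) he,
    abs_le_of_sq_le_sq (by nlinarith [sq_nonneg (p t)]) he,
    abs_le_of_sq_le_sq (by nlinarith [sq_nonneg (q t)]) he⟩

/-- Difference quotients at `0` are of the order of the frequency, uniformly on `(0,1]`. -/
theorem abs_slope_le (h : IsOscillatorFlow ν k p q r s) (hν : 0 ≤ ν) {t : ℝ}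
    (ht : t ∈ Ioc (0 : ℝ) 1) :
    |t⁻¹ * (p t - 1)| ≤ Real.exp |k| * (ν + |k|) ∧ |t⁻¹ * q t| ≤ Real.exp |k| * (ν + |k|) ∧
    |t⁻¹ * r t| ≤ Real.exp |k| * (ν + |k|) ∧ |t⁻¹ * (s t - 1)| ≤ Real.exp |k| * (ν + |k|) := by
  have hb : ∀ x ∈ Ico (0 : ℝ) t, |p x| ≤ Real.exp |k| ∧ |q x| ≤ Real.exp |k| ∧
      |r x| ≤ Real.exp |k| ∧ |s x| ≤ Real.exp |k| := by
    intro x hx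
    have h1 : Real.exp (|k| * x) ≤ Real.exp |k| := by
      apply Real.exp_le_exp.2
      exact mul_le_of_le_one_right (abs_nonneg k) (hx.2.le.trans ht.2)
    obtain ⟨h2, h3, h4, h5⟩ := h.abs_le hx.1
    exact ⟨h2.trans h1, h3.trans h1, h4.trans h1, h5.trans h1⟩
  have he := (Real.exp_pos |k|).le
  have hmv : ∀ {m m' : ℝ → ℝ}, (∀ x, HasDerivAt m (m' x) x) →
      (∀ x ∈ Ico (0 : ℝ) t, |m' x| ≤ Real.exp |k| * (ν + |k|)) →
      |t⁻¹ * (m t - m 0)| ≤ Real.exp |k| * (ν + |k|) := by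
    intro m m' hm hm'
    have h1 := norm_image_sub_le_of_norm_deriv_le_segment' (fun x _ => (hm x).hasDerivWithinAt)
      hm' t ⟨ht.1.le, le_rfl⟩
    rw [sub_zero, Real.norm_eq_abs] at h1
    rw [abs_mul, abs_inv, abs_of_pos ht.1, inv_mul_le_iff₀ ht.1]
    linarith
  have h1 : ∀ {x : ℝ}, |x| ≤ Real.exp |k| → |ν * x| ≤ Real.exp |k| * (ν + |k|) := by
    intro x hx
    rw [abs_mul, abs_of_nonneg hν]
    nlinarith [mul_le_mul_of_nonneg_left hx hν, mul_nonneg he (abs_nonneg k)]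
  have h2 : ∀ {x y : ℝ}, |x| ≤ Real.exp |k| → |y| ≤ Real.exp |k| →
      |-(ν * x) - k * y| ≤ Real.exp |k| * (ν + |k|) := by
    intro x y hx hy
    calc |-(ν * x) - k * y| ≤ |ν * x| + |k * y| := by
          rw [← abs_neg (ν * x)]; exact abs_sub _ _
      _ ≤ ν * Real.exp |k| + |k| * Real.exp |k| := by
          rw [abs_mul, abs_mul, abs_of_nonneg hν]; gcongr
      _ = _ := by ring
  refine ⟨?_, ?_, ?_, ?_⟩
  · simpa [h.p_zero] using hmv h.p_deriv fun x hx => h1 (hb x hx).2.2.1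
  · simpa [h.q_zero] using hmv h.q_deriv fun x hx => h1 (hb x hx).2.2.2
  · simpa [h.r_zero] using hmv h.r_deriv fun x hx => h2 (hb x hx).1 (hb x hx).2.2.1
  · simpa [h.s_zero] using hmv h.s_deriv fun x hx => h2 (hb x hx).2.1 (hb x hx).2.2.2

theorem tendsto_slope (h : IsOscillatorFlow ν k p q r s) :
    Tendsto (fun t => t⁻¹ * (p t - 1)) (𝓝[>] 0) (𝓝 0) ∧
    Tendsto (fun t => t⁻¹ * q t) (𝓝[>] 0) (𝓝 ν) ∧
    Tendsto (fun t => t⁻¹ * r t) (𝓝[>] 0) (𝓝 (-ν)) ∧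
    Tendsto (fun t => t⁻¹ * (s t - 1)) (𝓝[>] 0) (𝓝 (-k)) := by
  have h1 := (h.p_deriv 0).tendsto_slope_zero_right
  have h2 := (h.q_deriv 0).tendsto_slope_zero_right
  have h3 := (h.r_deriv 0).tendsto_slope_zero_right
  have h4 := (h.s_deriv 0).tendsto_slope_zero_right
  simp only [zero_add, h.p_zero, h.q_zero, h.r_zero, h.s_zero, smul_eq_mul, mul_zero, mul_one,
    sub_zero, neg_zero, zero_sub] at h1 h2 h3 h4
  exact ⟨h1, h2, h3, h4⟩

end IsOscillatorFlow

end Modes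

section Diagonal

variable {𝕜 H : Type*} [RCLike 𝕜] [NormedAddCommGroup H] [InnerProductSpace 𝕜 H]

/-- The operator that multiplies the `j`-th coordinate by `m j`, for a bounded sequence `m`. -/
def HilbertBasis.diagonal (b : HilbertBasis ℕ 𝕜 H) (m : ℕ → ℝ) (C : ℝ) (hm : ∀ j, |m j| ≤ C) :
    H →L[𝕜] H :=
  have hmem : ∀ x : H, Memℓp (fun j => (m j : 𝕜) * (b.repr x j : 𝕜)) 2 := fun x =>
    ((lp.memℓp (b.repr x)).const_smul (C : 𝕜)).mono' fun j => by
      rw [Pi.smul_apply, smul_eq_mul, norm_mul, norm_mul, RCLike.norm_ofReal, RCLike.norm_ofReal]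
      exact mul_le_mul_of_nonneg_right ((hm j).trans (le_abs_self C)) (norm_nonneg _)
  LinearMap.mkContinuous
    { toFun := fun x => b.repr.symm ⟨_, hmem x⟩
      map_add' := fun x y => by
        rw [← map_add]; congr 1; ext j; simp [mul_add]; rfl
      map_smul' := fun c x => by
        rw [RingHom.id_apply, ← map_smul]; congr 1; ext j; simp [mul_left_comm] }
    |C| fun x => by
      have h1 : ‖(⟨_, hmem x⟩ : lp (fun _ : ℕ => 𝕜) 2)‖ ≤ ‖(C : 𝕜) • b.repr x‖ :=
        lp.norm_mono (by norm_num) fun j => by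
          rw [lp.coeFn_smul, Pi.smul_apply, smul_eq_mul, norm_mul, norm_mul, RCLike.norm_ofReal,
            RCLike.norm_ofReal]
          exact mul_le_mul_of_nonneg_right ((hm j).trans (le_abs_self C)) (norm_nonneg _)
      rw [norm_smul, RCLike.norm_ofReal, LinearIsometryEquiv.norm_map] at h1
      simpa using h1

@[simp]
theorem HilbertBasis.repr_diagonal (b : HilbertBasis ℕ 𝕜 H) {m : ℕ → ℝ} {C : ℝ}
    (hm : ∀ j, |m j| ≤ C) (x : H) (j : ℕ) :
    b.repr (b.diagonal m C hm x) j = (m j : 𝕜) * b.repr x j := by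
  simp [HilbertBasis.diagonal]

/-- Dominated convergence for vectors whose coordinates are `α_t(j) a_j + β_t(j) c_j`. -/
theorem HilbertBasis.tendsto_of_dominated (b : HilbertBasis ℕ 𝕜 H) {l : Filter ℝ} [l.NeBot]
    {x : ℝ → H} {y : H} {α β : ℝ → ℕ → ℝ} {α₀ β₀ D : ℕ → ℝ} {a c : ℕ → 𝕜}
    (hx : ∀ᶠ t in l, ∀ j, b.repr (x t) j = (α t j : 𝕜) * a j + (β t j : 𝕜) * c j)
    (hy : ∀ j, b.repr y j = (α₀ j : 𝕜) * a j + (β₀ j : 𝕜) * c j)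
    (hα : ∀ j, Tendsto (fun t => α t j) l (𝓝 (α₀ j)))
    (hβ : ∀ j, Tendsto (fun t => β t j) l (𝓝 (β₀ j)))
    (hαD : ∀ᶠ t in l, ∀ j, |α t j| ≤ D j) (hβD : ∀ᶠ t in l, ∀ j, |β t j| ≤ D j)
    (ha : Memℓp (fun j => (D j : 𝕜) * a j) 2) (hc : Memℓp (fun j => (D j : 𝕜) * c j) 2) :
    Tendsto x l (𝓝 y) := by
  have hα0 : ∀ j, |α₀ j| ≤ D j := fun j =>
    le_of_tendsto (hα j).abs (hαD.mono fun t ht => ht j)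
  have hβ0 : ∀ j, |β₀ j| ≤ D j := fun j =>
    le_of_tendsto (hβ j).abs (hβD.mono fun t ht => ht j)
  have hnorm : ∀ z : H, ‖z‖ ^ 2 = ∑' j, ‖b.repr z j‖ ^ 2 := by
    intro z
    rw [← b.repr.norm_map]
    simpa using lp.norm_rpow_eq_tsum (p := 2) (by norm_num) (b.repr z)
  have hsumm : Summable fun j => 8 * (‖(D j : 𝕜) * a j‖ ^ 2 + ‖(D j : 𝕜) * c j‖ ^ 2) := by
    have h1 := ha.summable (by norm_num)
    have h2 := hc.summable (by norm_num)
    simp only [ENNReal.toReal_ofNat, Real.rpow_ofNat] at h1 h2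
    exact (h1.add h2).mul_left 8
  have key : Tendsto (fun t => ∑' j, ‖b.repr (x t - y) j‖ ^ 2) l (𝓝 (∑' _ : ℕ, (0 : ℝ))) := by
    refine tendsto_tsum_of_dominated_convergence hsumm (fun j => ?_) ?_
    · have h1 : Tendsto (fun t => (α t j : 𝕜) * a j + (β t j : 𝕜) * c j) l (𝓝 (b.repr y j)) := by
        rw [hy j]
        exact (((RCLike.continuous_ofReal.tendsto _).comp (hα j)).mul_const _).add
          (((RCLike.continuous_ofReal.tendsto _).comp (hβ j)).mul_const _)
      have h2 := ((h1.sub_const (b.repr y j)).norm).pow 2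
      rw [sub_self, norm_zero, zero_pow two_ne_zero] at h2
      refine h2.congr' ?_
      filter_upwards [hx] with t ht
      simp [← ht j]
    · filter_upwards [hx, hαD, hβD] with t ht h1 h2 j
      have h3 : b.repr (x t - y) j = ((α t j - α₀ j : ℝ) : 𝕜) * a j +
          ((β t j - β₀ j : ℝ) : 𝕜) * c j := by
        rw [map_sub, lp.coeFn_sub, Pi.sub_apply, ht j, hy j]
        push_cast; ring
      have hD : 0 ≤ D j := (abs_nonneg _).trans (h1 j)
      have h4 : ∀ z : 𝕜, ‖(D j : 𝕜) * z‖ = D j * ‖z‖ := fun z => by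
        rw [norm_mul, RCLike.norm_ofReal, abs_of_nonneg hD]
      have h5 : ‖b.repr (x t - y) j‖ ≤ 2 * D j * ‖a j‖ + 2 * D j * ‖c j‖ := by
        rw [h3]
        refine (norm_add_le _ _).trans ?_
        rw [norm_mul, norm_mul, RCLike.norm_ofReal, RCLike.norm_ofReal]
        gcongr
        · exact (abs_sub _ _).trans (by linarith [h1 j, hα0 j])
        · exact (abs_sub _ _).trans (by linarith [h2 j, hβ0 j])
      rw [norm_pow, norm_norm, h4, h4]
      calc ‖b.repr (x t - y) j‖ ^ 2 ≤ (2 * D j * ‖a j‖ + 2 * D j * ‖c j‖) ^ 2 := by gcongr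
        _ ≤ _ := by nlinarith [sq_nonneg (D j * ‖a j‖ - D j * ‖c j‖)]
  rw [tsum_zero] at key
  rw [tendsto_iff_norm_sub_tendsto_zero]
  have h6 := key.sqrt
  rw [Real.sqrt_zero] at h6
  refine h6.congr fun t => ?_
  rw [← hnorm, Real.sqrt_sq (norm_nonneg _)]

end Diagonal

/-! ### The semigroup on the energy space -/

section EnergySemigroup

theorem semigroupOf_spec {𝕜 Y : Type*} [RCLike 𝕜] [NormedAddCommGroup Y] [NormedSpace 𝕜 Y]
    [NormedSpace ℝ Y] {L : Y →ₗ.[𝕜] Y}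
    (h : ∃ S : ℝ → Y →L[𝕜] Y, IsC0Semigroup S ∧ IsGenerator S L) :
    IsC0Semigroup (semigroupOf L) ∧ IsGenerator (semigroupOf L) L := by
  rw [semigroupOf, dif_pos h]
  exact h.choose_spec

namespace PosDiscreteOp

variable {𝕜 H : Type*} [RCLike 𝕜] [NormedAddCommGroup H] [InnerProductSpace 𝕜 H]
  [CompleteSpace H] (A : PosDiscreteOp 𝕜 H)

/-- The frequency `√μ_j` of the `j`-th mode. -/
def freq (j : ℕ) : ℝ := A.eig j ^ (1 / 2 : ℝ)

theorem freq_nonneg (j : ℕ) : 0 ≤ A.freq j := Real.rpow_nonneg (A.eig_pos j).le _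

theorem freq_mul_self (j : ℕ) : A.freq j * A.freq j = A.eig j := by
  rw [freq, ← Real.sqrt_eq_rpow, Real.mul_self_sqrt (A.eig_pos j).le]

theorem repr_domPow_half (x : A.Dom (1 / 2)) (j : ℕ) :
    A.basis.repr (A.domPow (1 / 2) x) j = (A.freq j : 𝕜) * A.basis.repr (A.incl (1 / 2) x) j :=
  A.repr_apow (1 / 2) x j

theorem mem_powDomain_half_iff {x : H} :
    x ∈ A.powDomain (1 / 2) ↔ Memℓp (fun j => (A.freq j : 𝕜) * (A.basis.repr x j : 𝕜)) 2 :=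
  Iff.rfl

theorem mem_op_domain_iff {x : A.Dom (1 / 2)} : A.incl (1 / 2) x ∈ A.op.domain ↔
    Memℓp (fun j => (A.freq j : 𝕜) * (A.basis.repr (A.domPow (1 / 2) x) j : 𝕜)) 2 := by
  have h : (fun j => (A.freq j : 𝕜) * (A.basis.repr (A.domPow (1 / 2) x) j : 𝕜)) =
      fun j => ((A.eig j ^ (1 : ℝ) : ℝ) : 𝕜) • (A.basis.repr (A.incl (1 / 2) x) j : 𝕜) := by
    ext j
    rw [A.repr_domPow_half, ← mul_assoc, ← RCLike.ofReal_mul, A.freq_mul_self, Real.rpow_one,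
      smul_eq_mul]
  rw [← A.mem_powDomain_one, h]
  exact Iff.rfl

/-- The isometry `A^{1/2} : D(A^{1/2}) → H`. -/
def domPowEquiv : A.Dom (1 / 2) ≃ₗᵢ[𝕜] H :=
  LinearIsometryEquiv.ofSurjective ⟨A.domPow (1 / 2), fun _ => rfl⟩
    (A.domPow_surjective (by norm_num))

theorem domPow_domPowEquiv_symm (x : H) : A.domPow (1 / 2) (A.domPowEquiv.symm x) = x :=
  A.domPowEquiv.apply_symm_apply x

/-- Two elements of the energy space agree if their coordinates do; the coordinates of `(u, v)`
are those of `A^{1/2} u` and of `v`. -/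
theorem energySpace_ext {U V : EnergySpace A}
    (h1 : ∀ j, A.basis.repr (A.domPow (1 / 2) U.1) j = A.basis.repr (A.domPow (1 / 2) V.1) j)
    (h2 : ∀ j, A.basis.repr U.2 j = A.basis.repr V.2 j) : U = V := by
  refine Prod.ext (A.apow_injective (1 / 2) (A.basis.repr.injective ?_)) (A.basis.repr.injective ?_)
  · ext j; exact h1 j
  · ext j; exact h2 j

/-- The operator on the energy space that acts on the `j`-th pair of coordinates by the matrix
`[[p j, q j], [r j, s j]]`. -/
def blockDiagonal (p q r s : ℕ → ℝ) (C : ℝ) (hp : ∀ j, |p j| ≤ C) (hq : ∀ j, |q j| ≤ C)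
    (hr : ∀ j, |r j| ≤ C) (hs : ∀ j, |s j| ≤ C) : EnergySpace A →L[𝕜] EnergySpace A :=
  let fst : EnergySpace A →L[𝕜] H :=
    (A.domPowEquiv : A.Dom (1 / 2) →L[𝕜] H).comp (ContinuousLinearMap.fst 𝕜 _ _)
  let snd : EnergySpace A →L[𝕜] H := ContinuousLinearMap.snd 𝕜 _ _
  ((A.domPowEquiv.symm : H →L[𝕜] A.Dom (1 / 2)).comp
    ((A.basis.diagonal p C hp).comp fst + (A.basis.diagonal q C hq).comp snd)).prod
    ((A.basis.diagonal r C hr).comp fst + (A.basis.diagonal s C hs).comp snd)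

variable {A}

theorem repr_blockDiagonal_fst {p q r s : ℕ → ℝ} {C : ℝ} (hp : ∀ j, |p j| ≤ C)
    (hq : ∀ j, |q j| ≤ C) (hr : ∀ j, |r j| ≤ C) (hs : ∀ j, |s j| ≤ C) (U : EnergySpace A) (j : ℕ) :
    A.basis.repr (A.domPow (1 / 2) (A.blockDiagonal p q r s C hp hq hr hs U).1) j =
      (p j : 𝕜) * A.basis.repr (A.domPow (1 / 2) U.1) j + (q j : 𝕜) * A.basis.repr U.2 j := by
  have h : A.domPow (1 / 2) (A.blockDiagonal p q r s C hp hq hr hs U).1 =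
      A.basis.diagonal p C hp (A.domPow (1 / 2) U.1) + A.basis.diagonal q C hq U.2 :=
    A.domPow_domPowEquiv_symm _
  rw [h, map_add, lp.coeFn_add, Pi.add_apply, HilbertBasis.repr_diagonal,
    HilbertBasis.repr_diagonal]

theorem repr_blockDiagonal_snd {p q r s : ℕ → ℝ} {C : ℝ} (hp : ∀ j, |p j| ≤ C)
    (hq : ∀ j, |q j| ≤ C) (hr : ∀ j, |r j| ≤ C) (hs : ∀ j, |s j| ≤ C) (U : EnergySpace A) (j : ℕ) :
    A.basis.repr (A.blockDiagonal p q r s C hp hq hr hs U).2 j =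
      (r j : 𝕜) * A.basis.repr (A.domPow (1 / 2) U.1) j + (s j : 𝕜) * A.basis.repr U.2 j := by
  have h : (A.blockDiagonal p q r s C hp hq hr hs U).2 =
      A.basis.diagonal r C hr (A.domPow (1 / 2) U.1) + A.basis.diagonal s C hs U.2 := rfl
  rw [h, map_add, lp.coeFn_add, Pi.add_apply, HilbertBasis.repr_diagonal,
    HilbertBasis.repr_diagonal]

/-- Convergence in the energy space is convergence of both components. -/
theorem tendsto_energySpace {l : Filter ℝ} {x : ℝ → EnergySpace A} {y : EnergySpace A}
    (h1 : Tendsto (fun t => A.domPow (1 / 2) (x t).1) l (𝓝 (A.domPow (1 / 2) y.1)))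
    (h2 : Tendsto (fun t => (x t).2) l (𝓝 y.2)) : Tendsto x l (𝓝 y) := by
  refine Tendsto.prodMk_nhds (mx := fun t => (x t).1) (my := fun t => (x t).2) ?_ h2
  rw [(A.isometry_domPow (1 / 2)).isUniformInducing.isInducing.tendsto_nhds_iff]
  exact h1

variable (A)

/-- In coordinates `-𝒜` acts on the `j`-th mode by `[[0, √μ_j], [-√μ_j, -k]]`, on its maximal
domain. -/
theorem neg_firstOrderOp_iff {k : ℝ} {y z : EnergySpace A} :
    (∃ hy : y ∈ (-firstOrderOp A k).domain, (-firstOrderOp A k) ⟨y, hy⟩ = z) ↔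
      ∀ j, A.basis.repr (A.domPow (1 / 2) z.1) j = (A.freq j : 𝕜) * A.basis.repr y.2 j ∧
        A.basis.repr z.2 j = -((A.freq j : 𝕜) * A.basis.repr (A.domPow (1 / 2) y.1) j) -
          (k : 𝕜) * A.basis.repr y.2 j := by
  have hop : ∀ (hy : y ∈ (-firstOrderOp A k).domain) (j : ℕ),
      A.basis.repr (A.domPow (1 / 2) ((-firstOrderOp A k) ⟨y, hy⟩).1) j =
        (A.freq j : 𝕜) * A.basis.repr y.2 j ∧
      A.basis.repr ((-firstOrderOp A k) ⟨y, hy⟩).2 j =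
        -((A.freq j : 𝕜) * A.basis.repr (A.domPow (1 / 2) y.1) j) -
          (k : 𝕜) * A.basis.repr y.2 j := by
    intro hy j
    constructor
    · rw [A.repr_domPow_half, (firstOrderOp_neg_apply_eq ⟨hy, rfl⟩).2]
    · have h1 : ((-firstOrderOp A k) ⟨y, hy⟩).2 =
          -(A.op ⟨A.incl (1 / 2) y.1, hy.1⟩ + (k : 𝕜) • y.2) := rfl
      rw [h1, A.repr_domPow_half, ← mul_assoc, ← RCLike.ofReal_mul, A.freq_mul_self]
      simp only [map_neg, map_add, map_smul, lp.coeFn_neg, lp.coeFn_add, lp.coeFn_smul,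
        Pi.neg_apply, Pi.add_apply, Pi.smul_apply, smul_eq_mul, A.repr_op]
      ring
  constructor
  · rintro ⟨hy, rfl⟩ j
    exact hop hy j
  · intro h
    have hy2 : y.2 ∈ A.powDomain (1 / 2) := by
      rw [A.mem_powDomain_half_iff]
      simp only [← fun j => (h j).1]
      exact lp.memℓp _
    have hy1 : A.incl (1 / 2) y.1 ∈ A.op.domain := by
      rw [A.mem_op_domain_iff]
      have h1 : (fun j => (A.freq j : 𝕜) * (A.basis.repr (A.domPow (1 / 2) y.1) j : 𝕜)) =
          (A.basis.repr (-z.2 - (k : 𝕜) • y.2) : ℕ → 𝕜) := by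
        ext j
        simp only [map_sub, map_neg, map_smul, lp.coeFn_neg, lp.coeFn_sub, lp.coeFn_smul,
          Pi.neg_apply, Pi.sub_apply, Pi.smul_apply, smul_eq_mul, (h j).2]
        ring
      rw [h1]
      exact lp.memℓp _
    have hy : y ∈ (-firstOrderOp A k).domain := ⟨hy1, hy2⟩
    exact ⟨hy, A.energySpace_ext (fun j => ((hop hy j).1).trans (h j).1.symm)
      fun j => ((hop hy j).2).trans (h j).2.symm⟩

/-- The operator `-𝒜` generates a `C₀`-semigroup on the energy space, namely the one that moves
each mode by the flow of a damped oscillator. -/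
theorem exists_energySemigroup [NormedSpace ℝ H] [IsScalarTower ℝ 𝕜 H] (k : ℝ) :
    ∃ S : ℝ → EnergySpace A →L[𝕜] EnergySpace A,
      IsC0Semigroup S ∧ IsGenerator S (-firstOrderOp A k) := by
  choose p q r s hflow using fun j => exists_isOscillatorFlow (A.freq j) k
  have hb := fun (t : ℝ) (j : ℕ) => (hflow j).abs_le (le_max_right t 0)
  -- For `t < 0` the flows need not be bounded by `e^{|k|t}`; the value at `0` is taken there.
  set S : ℝ → EnergySpace A →L[𝕜] EnergySpace A := fun t =>
    A.blockDiagonal (fun j => p j (max t 0)) (fun j => q j (max t 0)) (fun j => r j (max t 0))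
      (fun j => s j (max t 0)) (Real.exp (|k| * max t 0)) (fun j => (hb t j).1)
      (fun j => (hb t j).2.1) (fun j => (hb t j).2.2.1) (fun j => (hb t j).2.2.2) with hSdef
  have hS1 : ∀ t U j, 0 ≤ t → A.basis.repr (A.domPow (1 / 2) (S t U).1) j =
      (p j t : 𝕜) * A.basis.repr (A.domPow (1 / 2) U.1) j + (q j t : 𝕜) * A.basis.repr U.2 j := by
    intro t U j ht
    have := repr_blockDiagonal_fst (fun j => (hb t j).1) (fun j => (hb t j).2.1)
      (fun j => (hb t j).2.2.1) (fun j => (hb t j).2.2.2) U j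
    simpa only [hSdef, max_eq_left ht] using this
  have hS2 : ∀ t U j, 0 ≤ t → A.basis.repr (S t U).2 j =
      (r j t : 𝕜) * A.basis.repr (A.domPow (1 / 2) U.1) j + (s j t : 𝕜) * A.basis.repr U.2 j := by
    intro t U j ht
    have := repr_blockDiagonal_snd (fun j => (hb t j).1) (fun j => (hb t j).2.1)
      (fun j => (hb t j).2.2.1) (fun j => (hb t j).2.2.2) U j
    simpa only [hSdef, max_eq_left ht] using this
  have hbound : ∀ᶠ t in 𝓝[>] (0 : ℝ), ∀ j, |p j t| ≤ Real.exp |k| ∧ |q j t| ≤ Real.exp |k| ∧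
      |r j t| ≤ Real.exp |k| ∧ |s j t| ≤ Real.exp |k| := by
    filter_upwards [Ioc_mem_nhdsGT zero_lt_one] with t ht j
    have h1 : Real.exp (|k| * t) ≤ Real.exp |k| :=
      Real.exp_le_exp.2 (mul_le_of_le_one_right (abs_nonneg k) ht.2)
    obtain ⟨h2, h3, h4, h5⟩ := (hflow j).abs_le ht.1.le
    exact ⟨h2.trans h1, h3.trans h1, h4.trans h1, h5.trans h1⟩
  have hslope : ∀ᶠ t in 𝓝[>] (0 : ℝ), ∀ j,
      |t⁻¹ * (p j t - 1)| ≤ Real.exp |k| * (A.freq j + |k|) ∧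
      |t⁻¹ * q j t| ≤ Real.exp |k| * (A.freq j + |k|) ∧
      |t⁻¹ * r j t| ≤ Real.exp |k| * (A.freq j + |k|) ∧
      |t⁻¹ * (s j t - 1)| ≤ Real.exp |k| * (A.freq j + |k|) := by
    filter_upwards [Ioc_mem_nhdsGT zero_lt_one] with t ht j
    exact (hflow j).abs_slope_le (A.freq_nonneg j) ht
  have hlp : ∀ (C : ℝ) (x : H), Memℓp (fun j => ((C : ℝ) : 𝕜) * (A.basis.repr x j : 𝕜)) 2 :=
    fun C x => (lp.memℓp (A.basis.repr x)).const_smul (C : 𝕜)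
  have hpos : ∀ᶠ t in 𝓝[>] (0 : ℝ), 0 < t := self_mem_nhdsWithin
  have hlim : ∀ {m : ℝ → ℝ} {m' : ℝ}, HasDerivAt m m' 0 → Tendsto m (𝓝[>] 0) (𝓝 (m 0)) :=
    fun h => h.continuousAt.tendsto.mono_left nhdsWithin_le_nhds
  have hsm : ∀ (c : ℝ) (x : H) (j : ℕ), A.basis.repr (c • x) j = (c : 𝕜) * A.basis.repr x j := by
    intro c x j
    rw [RCLike.real_smul_eq_coe_smul (K := 𝕜), map_smul, lp.coeFn_smul, Pi.smul_apply, smul_eq_mul]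
  have hquot1 : ∀ (t : ℝ) (y : EnergySpace A) (j : ℕ), 0 < t →
      A.basis.repr (A.domPow (1 / 2) (t⁻¹ • (S t y - y)).1) j =
        ((t⁻¹ * (p j t - 1) : ℝ) : 𝕜) * A.basis.repr (A.domPow (1 / 2) y.1) j +
          ((t⁻¹ * q j t : ℝ) : 𝕜) * A.basis.repr y.2 j := by
    intro t y j ht
    have h1 : A.domPow (1 / 2) (t⁻¹ • (S t y - y)).1 =
        t⁻¹ • (A.domPow (1 / 2) (S t y).1 - A.domPow (1 / 2) y.1) := by
      rw [← map_sub]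
      exact map_real_smul (A.domPow (1 / 2)) (A.isometry_domPow (1 / 2)).continuous _ _
    rw [h1, hsm, map_sub, lp.coeFn_sub, Pi.sub_apply, hS1 t y j ht.le]
    push_cast; ring
  have hquot2 : ∀ (t : ℝ) (y : EnergySpace A) (j : ℕ), 0 < t →
      A.basis.repr (t⁻¹ • (S t y - y)).2 j =
        ((t⁻¹ * r j t : ℝ) : 𝕜) * A.basis.repr (A.domPow (1 / 2) y.1) j +
          ((t⁻¹ * (s j t - 1) : ℝ) : 𝕜) * A.basis.repr y.2 j := by
    intro t y j ht
    have h1 : (t⁻¹ • (S t y - y)).2 = t⁻¹ • ((S t y).2 - y.2) := rfl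
    rw [h1, hsm, map_sub, lp.coeFn_sub, Pi.sub_apply, hS2 t y j ht.le]
    push_cast; ring
  refine ⟨S, ⟨?_, ?_, ?_⟩, fun y z => ?_⟩
  · refine ContinuousLinearMap.ext fun U => ?_
    refine A.energySpace_ext (fun j => ?_) fun j => ?_
    · rw [hS1 0 U j le_rfl, (hflow j).p_zero, (hflow j).q_zero]; simp
    · rw [hS2 0 U j le_rfl, (hflow j).r_zero, (hflow j).s_zero]; simp
  · intro t τ ht hτ
    refine ContinuousLinearMap.ext fun U => ?_
    refine A.energySpace_ext (fun j => ?_) fun j => ?_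
    · rw [ContinuousLinearMap.comp_apply, hS1 _ _ j (add_nonneg ht hτ), hS1 t _ j ht,
        hS1 τ U j hτ, hS2 τ U j hτ, (hflow j).p_add, (hflow j).q_add]
      push_cast; ring
    · rw [ContinuousLinearMap.comp_apply, hS2 _ _ j (add_nonneg ht hτ), hS2 t _ j ht,
        hS1 τ U j hτ, hS2 τ U j hτ, (hflow j).r_add, (hflow j).s_add]
      push_cast; ring
  · intro y
    refine tendsto_energySpace ?_ ?_
    · exact A.basis.tendsto_of_dominated (α₀ := fun _ => 1) (β₀ := fun _ => 0)
        (D := fun _ => Real.exp |k|) (hpos.mono fun t ht j => hS1 t y j ht.le) (by simp)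
        (fun j => by simpa [(hflow j).p_zero] using hlim ((hflow j).p_deriv 0))
        (fun j => by simpa [(hflow j).q_zero] using hlim ((hflow j).q_deriv 0))
        (hbound.mono fun t ht j => (ht j).1) (hbound.mono fun t ht j => (ht j).2.1)
        (hlp _ _) (hlp _ _)
    · exact A.basis.tendsto_of_dominated (α₀ := fun _ => 0) (β₀ := fun _ => 1)
        (D := fun _ => Real.exp |k|) (hpos.mono fun t ht j => hS2 t y j ht.le) (by simp)
        (fun j => by simpa [(hflow j).r_zero] using hlim ((hflow j).r_deriv 0))
        (fun j => by simpa [(hflow j).s_zero] using hlim ((hflow j).s_deriv 0))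
        (hbound.mono fun t ht j => (ht j).2.2.1) (hbound.mono fun t ht j => (ht j).2.2.2)
        (hlp _ _) (hlp _ _)
  · constructor
    · intro hyz
      have hz := A.neg_firstOrderOp_iff.1 hyz
      obtain ⟨hy, -⟩ := hyz
      -- On the domain, the majorant `√μ_j + |k|` of the difference quotients is square summable
      -- against the coordinates.
      have hD : ∀ x : H, Memℓp (fun j => (A.freq j : 𝕜) * (A.basis.repr x j : 𝕜)) 2 →
          Memℓp (fun j => ((Real.exp |k| * (A.freq j + |k|) : ℝ) : 𝕜) *
            (A.basis.repr x j : 𝕜)) 2 := by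
        intro x hx
        convert (hx.add (hlp |k| x)).const_smul ((Real.exp |k| : ℝ) : 𝕜) using 1
        ext j
        simp only [Pi.smul_apply, Pi.add_apply, smul_eq_mul]
        push_cast; ring
      have hD1 := hD _ (A.mem_op_domain_iff.1 hy.1)
      have hD2 := hD _ (A.mem_powDomain_half_iff.1 hy.2)
      refine tendsto_energySpace ?_ ?_
      · exact A.basis.tendsto_of_dominated (α₀ := fun _ => 0) (β₀ := A.freq)
          (hpos.mono fun t ht j => hquot1 t y j ht) (fun j => by simp [(hz j).1])
          (fun j => (hflow j).tendsto_slope.1) (fun j => (hflow j).tendsto_slope.2.1)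
          (hslope.mono fun t ht j => (ht j).1) (hslope.mono fun t ht j => (ht j).2.1) hD1 hD2
      · exact A.basis.tendsto_of_dominated (α₀ := fun j => -A.freq j) (β₀ := fun _ => -k)
          (hpos.mono fun t ht j => hquot2 t y j ht) (fun j => by rw [(hz j).2]; push_cast; ring)
          (fun j => (hflow j).tendsto_slope.2.2.1) (fun j => (hflow j).tendsto_slope.2.2.2)
          (hslope.mono fun t ht j => (ht j).2.2.1) (hslope.mono fun t ht j => (ht j).2.2.2) hD1 hD2
    · intro h
      rw [A.neg_firstOrderOp_iff]
      have hcoord : ∀ {x : ℝ → H} {w : H} (j : ℕ), Tendsto x (𝓝[>] 0) (𝓝 w) →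
          Tendsto (fun t => (A.basis.repr (x t) j : 𝕜)) (𝓝[>] 0) (𝓝 (A.basis.repr w j)) := by
        intro x w j hx
        simp only [A.basis.repr_apply_apply]
        exact tendsto_const_nhds.inner hx
      have hcast : ∀ {m : ℝ → ℝ} {c : ℝ} (z : 𝕜), Tendsto m (𝓝[>] 0) (𝓝 c) →
          Tendsto (fun t => (m t : 𝕜) * z) (𝓝[>] 0) (𝓝 ((c : 𝕜) * z)) := fun z hm =>
        ((RCLike.continuous_ofReal.tendsto _).comp hm).mul_const z
      intro j
      obtain ⟨h1, h2, h3, h4⟩ := (hflow j).tendsto_slope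
      constructor
      · have h5 := hcoord j (((A.isometry_domPow (1 / 2)).continuous.tendsto _).comp
          ((continuous_fst.tendsto z).comp h))
        refine tendsto_nhds_unique h5 ?_
        have h6 := (hcast (A.basis.repr (A.domPow (1 / 2) y.1) j) h1).add
          (hcast (A.basis.repr y.2 j) h2)
        rw [RCLike.ofReal_zero, zero_mul, zero_add] at h6
        refine h6.congr' ?_
        filter_upwards [hpos] with t ht
        exact (hquot1 t y j ht).symm
      · have h5 := hcoord j ((continuous_snd.tendsto z).comp h)
        refine tendsto_nhds_unique h5 ?_
        have h6 := (hcast (A.basis.repr (A.domPow (1 / 2) y.1) j) h3).add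
          (hcast (A.basis.repr y.2 j) h4)
        rw [RCLike.ofReal_neg, RCLike.ofReal_neg, neg_mul, neg_mul, ← sub_eq_add_neg] at h6
        refine h6.congr' ?_
        filter_upwards [hpos] with t ht
        exact (hquot2 t y j ht).symm

end PosDiscreteOp

end EnergySemigroup

end

theorem corollary2p1 {𝕜 H : Type*} [RCLike 𝕜] [NormedAddCommGroup H] [InnerProductSpace 𝕜 H]
    [CompleteSpace H] [NormedSpace ℝ H] [IsScalarTower ℝ 𝕜 H]
    (A : PosDiscreteOp 𝕜 H) (k h : ℝ) (hh : 0 < h)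
    (F : A.Dom (1 / 2) → H) (M : PhaseSpace A h → H)
    (hF1 : CondF1 F) (hF2 : CondF2 F) (hM1 : CondM1Strong M) (hM2 : CondM2 M)
    (φ : PhaseSpace A h)
    (hφ0 : A.incl (1 / 2) (φ.posZero hh) ∈ A.op.domain)
    (hφ1 : φ.velZero hh ∈ A.powDomain (1 / 2))
    (u : Trajectory A h) (hu : IsMildSolution k F M φ u) :
    (∀ T > 0,
      MemLinftyDom A 1 T (fun t => A.incl (1 / 2) (u.pos t)) ∧
      MemLinftyDom A (1 / 2) T u.vel ∧
      DerivMemLinfty T u.vel) ∧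
    (CondFDiff F →
      ContOnDom A 1 (fun t => A.incl (1 / 2) (u.pos t)) ∧
      ContOnDom A (1 / 2) u.vel ∧
      DerivContOn u.vel) := by
  obtain ⟨hS, hL⟩ := semigroupOf_spec (A.exists_energySemigroup k)
  obtain ⟨h1, h2, h3⟩ := hu.contOnDom hh hS hL hF1 hM1 hφ0 hφ1
  exact ⟨fun T hT => ⟨h1.memLinftyDom T, h2.memLinftyDom T, h3.derivMemLinfty hT⟩,
    fun _ => ⟨h1, h2, h3⟩⟩
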